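/- **Setting.** Fix a complete separable metric space $\Xi$ (the mark space). A *network* is a connected, locally finite (multi-)graph $G$ whose vertices $v$ and whose incident pairs $(v,e)$ of a vertex and an edge carry marks in $\Xi$; $d$ is the graph distance and $N_r(v)$ the set of vertices at distance at most $r$ from $v$. Let $\mathcal G_*$ (resp. $\mathcal G_{**}$) be the set of classes $[G,o]$ (resp. $[G,o,v]$) of networks with one (resp. an ordered pair of) distinguished vertices, up to isomorphisms which preserve marks and distinguished vertices, with the Borel $\sigma$-field of the topology of local convergence (two classes are close if large balls around the distinguished vertices are isomorphic with close corresponding marks). For $g:\mathcal G_{**}\to\mathbb R^{\ge 0}$ write $g_G(u,v)=g[G,u,v]$, $g_G^+(o)=\sum_{v\in V(G)}g_G(o,v)$ and $g_G^-(o)=\sum_{v\in V(G)}g_G(v,o)$. A random element $[\boldsymbol G,\boldsymbol o]$ of $\mathcal G_*$ is *unimodular* if $\mathbb E[g^+_{\boldsymbol G}(\boldsymbol o)]=\mathbb E[g^-_{\boldsymbol G}(\boldsymbol o)]$ (in $[0,\infty]$) for all measurable $g:\mathcal G_{**}\to\mathbb R^{\ge0}$. The *invariant $\sigma$-field* $I$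 consists of the measurable $B\subseteq\mathcal G_*$ such that $[G,o]\in B$ implies $[G,v]\in B$ for all $v\in V(G)$. **Stable transport algorithm.** Let $w_1,w_2:\mathcal G_*\to\mathbb R^{\ge0}$ be measurable and let $G$ be a network. Put $R_0=0$ on $V(G)\times V(G)$. For $n\ge1$ do the following, with $\min\emptyset=\infty$. (i) For each $x\in V(G)$ let $$a_n(x)=\min\Big\{a\ge0:\sum_{\xi\in N_a(x)}\big(w_2[G,\xi]-R_{n-1}(x,\xi)\big)\ge w_1[G,x]\Big\},$$ and let $A_n(x,\xi)$ be $w_2[G,\xi]$ if $d(x,\xi)<a_n(x)$, be $cR_{n-1}(x,\xi)+(1-c)w_2[G,\xi]$ if $d(x,\xi)=a_n(x)$, and be $0$ if $d(x,\xi)>a_n(x)$, where, if $a_n(x)<\infty$, $c=c_n(x)\in[0,1]$ is chosen such that $\sum_{\xi}(A_n(x,\xi)-R_{n-1}(x,\xi))=w_1[G,x]$. (ii) For each $\xi\in V(G)$ let $$r_n(\xi)=\min\Big\{r\ge0:\sum_{x\in N_r(\xi)}A_n(x,\xi)\ge w_2[G,\xi]\Big\},$$ and let $R_n(x,\xi)$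 be $0$ if $d(x,\xi)<r_n(\xi)$, be $c'A_n(x,\xi)$ if $d(x,\xi)=r_n(\xi)$, and be $A_n(x,\xi)$ if $d(x,\xi)>r_n(\xi)$, where, if $r_n(\xi)<\infty$, $c'=c'_n(\xi)\in[0,1]$ is chosen such that $\sum_{x}(A_n(x,\xi)-R_n(x,\xi))=w_2[G,\xi]$. Finally, $T_G(x,\xi):=\lim_{n}A_n(x,\xi)-\lim_{n}R_n(x,\xi)$. **Theorem (Construction of a Balancing Transport Kernel).** Let $[\boldsymbol G,\boldsymbol o]$ be a unimodular network and let $w_1,w_2:\mathcal G_*\to\mathbb R^{\ge0}$ be measurable functions such that $$\mathbb E\big[w_1[\boldsymbol G,\boldsymbol o]\,\big|\,I\big]=\mathbb E\big[w_2[\boldsymbol G,\boldsymbol o]\,\big|\,I\big]<\infty\quad\text{a.s.}$$ Then the algorithm is well defined on every network (the required $c$ and $c'$ exist, their choice does not affect $A_n$ and $R_n$, and the limits exist), it defines a measurable function $T:\mathcal G_{**}\to\mathbb R^{\ge0}$, $T[G,x,\xi]=T_G(x,\xi)$, and $T$ balances between $w_1$ and $w_2$: almost surely, $$T^+_{\boldsymbol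 G}(v)=w_1[\boldsymbol G,v]\quad\text{and}\quad T^-_{\boldsymbol G}(v)=w_2[\boldsymbol G,v]\qquad\text{for all }v\in V(\boldsymbol G).$$ -/

import Mathlib

open Set Filter Topology MeasureTheory
open scoped NNReal ENNReal

/-! ## Networks -/

/-- A multigraph (multiple edges and loops are allowed) whose vertices `v` and whose incident pairs
`(v, e)` carry marks in `Ξ`. No connectedness or finiteness is required at this level. -/
structure MarkedMultigraph.{u} (Ξ : Type u) where
  /-- vertices -/
  V : Type
  /-- edges -/
  E : Type
  /-- the two end-vertices of an edge -/
  ends : E → Sym2 V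
  /-- the mark of a vertex -/
  vmark : V → Ξ
  /-- the mark of an edge at one of its end-vertices -/
  emark : {p : V × E // p.1 ∈ ends p.2} → Ξ

namespace MarkedMultigraph

universe u
variable {Ξ : Type u}

/-- Adjacency of distinct vertices; it determines connectedness and the graph distance. -/
def graph (G : MarkedMultigraph Ξ) : SimpleGraph G.V where
  Adj x y := x ≠ y ∧ ∃ e, G.ends e = s(x, y)
  symm := ⟨fun x y h => ⟨h.1.symm, by
    obtain ⟨e, he⟩ := h.2
    exact ⟨e, he.trans Sym2.eq_swap⟩⟩⟩
  loopless := ⟨fun _ h => h.1 rfl⟩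

/-- Every vertex has finite degree. -/
def LocallyFinite (G : MarkedMultigraph Ξ) : Prop :=
  ∀ v, {e | v ∈ G.ends e}.Finite

/-- The marked multigraph induced on a set of vertices: its edges are those with both ends in the
set. -/
def induce (G : MarkedMultigraph Ξ) (S : Set G.V) : MarkedMultigraph Ξ where
  V := {v // v ∈ S}
  E := {e // ∀ v ∈ G.ends e, v ∈ S}
  ends e := (G.ends e.1).attachWith e.2
  vmark v := G.vmark v.1
  emark p := G.emark ⟨(p.1.1.1, p.1.2.1), by
    have h := Sym2.attachWith_map_subtypeVal p.1.2.2
    rw [← h]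
    exact Sym2.mem_map.2 ⟨p.1.1, p.2, rfl⟩⟩

/-- An isomorphism of the underlying multigraphs (marks are ignored). -/
structure GraphIso (G H : MarkedMultigraph Ξ) where
  /-- the bijection of the vertices -/
  toV : G.V ≃ H.V
  /-- the bijection of the edges -/
  toE : G.E ≃ H.E
  /-- incidence is preserved -/
  mem_ends : ∀ (v : G.V) (e : G.E), v ∈ G.ends e ↔ toV v ∈ H.ends (toE e)

/-- The isomorphism preserves the marks of the vertices and of the incident pairs. -/
def GraphIso.PreservesMarks {G H : MarkedMultigraph Ξ} (f : GraphIso G H) : Prop :=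
  (∀ v, H.vmark (f.toV v) = G.vmark v) ∧
    ∀ (v : G.V) (e : G.E) (h : v ∈ G.ends e),
      H.emark ⟨(f.toV v, f.toE e), (f.mem_ends v e).1 h⟩ = G.emark ⟨(v, e), h⟩

/-- Corresponding marks are at distance less than `ε`. -/
def GraphIso.MarksWithin [MetricSpace Ξ] {G H : MarkedMultigraph Ξ} (f : GraphIso G H) (ε : ℝ) :
    Prop :=
  (∀ v, dist (G.vmark v) (H.vmark (f.toV v)) < ε) ∧
    ∀ (v : G.V) (e : G.E) (h : v ∈ G.ends e),
      dist (G.emark ⟨(v, e), h⟩) (H.emark ⟨(f.toV v, f.toE e), (f.mem_ends v e).1 h⟩) < ε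

/-- The identity. -/
def GraphIso.refl (G : MarkedMultigraph Ξ) : GraphIso G G :=
  ⟨Equiv.refl _, Equiv.refl _, fun _ _ => Iff.rfl⟩

/-- The inverse isomorphism. -/
def GraphIso.symm {G H : MarkedMultigraph Ξ} (f : GraphIso G H) : GraphIso H G :=
  ⟨f.toV.symm, f.toE.symm, fun v e => by
    rw [f.mem_ends, Equiv.apply_symm_apply, Equiv.apply_symm_apply]⟩

/-- Composition of isomorphisms. -/
def GraphIso.trans {G H K : MarkedMultigraph Ξ} (f : GraphIso G H) (g : GraphIso H K) :
    GraphIso G K :=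
  ⟨f.toV.trans g.toV, f.toE.trans g.toE, fun v e => by
    rw [f.mem_ends, g.mem_ends]; rfl⟩

lemma GraphIso.PreservesMarks.refl (G : MarkedMultigraph Ξ) : (GraphIso.refl G).PreservesMarks :=
  ⟨fun _ => rfl, fun _ _ _ => rfl⟩

lemma GraphIso.PreservesMarks.symm {G H : MarkedMultigraph Ξ} {f : GraphIso G H}
    (hf : f.PreservesMarks) : f.symm.PreservesMarks := by
  refine ⟨fun v => ?_, fun v e h => ?_⟩
  · rw [← hf.1]
    congr 1
    exact f.toV.apply_symm_apply v
  · rw [← hf.2]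
    congr 2
    exact Prod.ext (f.toV.apply_symm_apply v) (f.toE.apply_symm_apply e)

lemma GraphIso.PreservesMarks.trans {G H K : MarkedMultigraph Ξ} {f : GraphIso G H}
    {g : GraphIso H K} (hf : f.PreservesMarks) (hg : g.PreservesMarks) :
    (f.trans g).PreservesMarks :=
  ⟨fun v => (hg.1 _).trans (hf.1 v), fun v e h => (hg.2 _ _ _).trans (hf.2 v e h)⟩

lemma GraphIso.ends_eq {G H : MarkedMultigraph Ξ} (f : GraphIso G H) (e : G.E) :
    H.ends (f.toE e) = (G.ends e).map f.toV := by
  refine Sym2.ext fun y => ?_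
  obtain ⟨x, rfl⟩ := f.toV.surjective y
  rw [← f.mem_ends, Sym2.mem_map]
  constructor
  · exact fun h => ⟨x, h, rfl⟩
  · rintro ⟨z, hz, hzx⟩
    exact f.toV.injective hzx ▸ hz

lemma GraphIso.adj {G H : MarkedMultigraph Ξ} (f : GraphIso G H) {x y : G.V}
    (h : G.graph.Adj x y) : H.graph.Adj (f.toV x) (f.toV y) := by
  obtain ⟨hne, e, he⟩ := h
  exact ⟨fun h' => hne (f.toV.injective h'), f.toE e, by rw [f.ends_eq, he]; rfl⟩

lemma GraphIso.dist_le {G H : MarkedMultigraph Ξ} (f : GraphIso G H) (hG : G.graph.Connected)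
    (x y : G.V) : H.graph.dist (f.toV x) (f.toV y) ≤ G.graph.dist x y := by
  obtain ⟨w, hw⟩ := hG.exists_walk_length_eq_dist x y
  let φ : G.graph →g H.graph := ⟨f.toV, fun h => f.adj h⟩
  rw [← hw, ← SimpleGraph.Walk.length_map φ w]
  exact SimpleGraph.dist_le _

lemma GraphIso.dist_eq {G H : MarkedMultigraph Ξ} (f : GraphIso G H) (hG : G.graph.Connected)
    (hH : H.graph.Connected) (x y : G.V) :
    H.graph.dist (f.toV x) (f.toV y) = G.graph.dist x y := by
  refine le_antisymm (f.dist_le hG x y) ?_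
  have h := f.symm.dist_le hH (f.toV x) (f.toV y)
  have e : ∀ z, f.symm.toV (f.toV z) = z := fun z => f.toV.symm_apply_apply z
  rwa [e, e] at h

end MarkedMultigraph

/-- A network with mark space `Ξ`: a connected, locally finite, marked multigraph. Such a multigraph
is countable, so that vertex and edge sets in `Type` give all isomorphism classes. -/
structure Network.{u} (Ξ : Type u) extends MarkedMultigraph Ξ where
  connected : toMarkedMultigraph.graph.Connected
  locallyFinite : toMarkedMultigraph.LocallyFinite

/-- A network with `k` distinguished vertices (roots). -/
structure RootedNetwork.{u} (Ξ : Type u) (k : ℕ) extends Network Ξ where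
  root : Fin k → V

namespace RootedNetwork

universe u
variable {Ξ : Type u} {k : ℕ}

/-- Rooted isomorphism: a network isomorphism which maps the roots to the roots. -/
def Isomorphic (X Y : RootedNetwork Ξ k) : Prop :=
  ∃ f : MarkedMultigraph.GraphIso X.toMarkedMultigraph Y.toMarkedMultigraph,
    f.PreservesMarks ∧ ∀ i, f.toV (X.root i) = Y.root i

instance isomorphicSetoid (Ξ : Type u) (k : ℕ) : Setoid (RootedNetwork Ξ k) where
  r := Isomorphic
  iseqv :=
    { refl := fun X => ⟨.refl _, .refl _, fun _ => rfl⟩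
      symm := by
        rintro X Y ⟨f, hf, h⟩
        refine ⟨f.symm, hf.symm, fun i => ?_⟩
        rw [← h]
        exact f.toV.symm_apply_apply _
      trans := by
        rintro X Y Z ⟨f, hf, h⟩ ⟨g, hg, h'⟩
        refine ⟨f.trans g, hf.trans hg, fun i => ?_⟩
        rw [← h', ← h]
        rfl }

/-- The vertices within graph distance `n` of one of the roots. -/
def nbhd (X : RootedNetwork Ξ k) (n : ℕ) : Set X.V :=
  {v | ∃ i, X.graph.dist (X.root i) v ≤ n}

lemma root_mem_nbhd (X : RootedNetwork Ξ k) (n : ℕ) (i : Fin k) : X.root i ∈ X.nbhd n :=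
  ⟨i, by simp⟩

/-- The `n`-neighbourhoods of the roots of `X` and `Y` are isomorphic, by an isomorphism which maps
roots to roots and for which corresponding marks are at distance less than `1 / (n + 1)`. -/
def Near [MetricSpace Ξ] (n : ℕ) (X Y : RootedNetwork Ξ k) : Prop :=
  ∃ f : MarkedMultigraph.GraphIso (X.induce (X.nbhd n)) (Y.induce (Y.nbhd n)),
    f.MarksWithin (1 / ((n : ℝ) + 1)) ∧
      ∀ i, f.toV ⟨X.root i, X.root_mem_nbhd n i⟩ = ⟨Y.root i, Y.root_mem_nbhd n i⟩

end RootedNetwork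

/-- The set of isomorphism classes of networks with `k` roots. -/
def NetworkClass.{u} (Ξ : Type u) (k : ℕ) : Type (max 1 u) :=
  Quotient (RootedNetwork.isomorphicSetoid Ξ k)

/-- The space `𝒢_*` of isomorphism classes of rooted networks. -/
abbrev GStar.{u} (Ξ : Type u) : Type (max 1 u) := NetworkClass Ξ 1

/-- The space `𝒢_**` of isomorphism classes of doubly-rooted networks. -/
abbrev GStarStar.{u} (Ξ : Type u) : Type (max 1 u) := NetworkClass Ξ 2

section Spaces

universe u
variable {Ξ : Type u} {k : ℕ}

/-- The isomorphism class of a network with `k` roots. -/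
def RootedNetwork.cls (X : RootedNetwork Ξ k) : NetworkClass Ξ k :=
  Quotient.mk (RootedNetwork.isomorphicSetoid Ξ k) X

/-- `[G, o]` -/
def Network.cls₁ (G : Network Ξ) (o : G.V) : GStar Ξ :=
  RootedNetwork.cls ⟨G, ![o]⟩

/-- `[G, o, v]` -/
def Network.cls₂ (G : Network Ξ) (o v : G.V) : GStarStar Ξ :=
  RootedNetwork.cls ⟨G, ![o, v]⟩

/-- The topology of local convergence: it is given by the metric in which two classes are at
distance `1 / (1 + α)`, where `α` is the supremum of those `r > 0` for which the `⌊r⌋`-neighbourhoods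
of the roots are isomorphic, preserving the roots, with corresponding marks at distance less than
`1 / r`. (A set is open if with each class it contains a ball of this metric; since an isomorphism of
neighbourhoods restricts to smaller ones, integer radii are enough.) -/
instance NetworkClass.instTopologicalSpace [MetricSpace Ξ] :
    TopologicalSpace (NetworkClass Ξ k) where
  IsOpen U := ∀ X : RootedNetwork Ξ k, X.cls ∈ U →
    ∃ n : ℕ, ∀ m ≥ n, ∀ Y : RootedNetwork Ξ k, X.Near m Y → Y.cls ∈ U
  isOpen_univ := fun _ _ => ⟨0, fun _ _ _ _ => trivial⟩
  isOpen_inter := by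
    intro U W hU hW X hX
    obtain ⟨n, hn⟩ := hU X hX.1
    obtain ⟨m, hm⟩ := hW X hX.2
    exact ⟨max n m, fun l hl Y h =>
      ⟨hn l ((le_max_left n m).trans hl) Y h, hm l ((le_max_right n m).trans hl) Y h⟩⟩
  isOpen_sUnion := by
    intro s hs X hX
    obtain ⟨U, hU, hXU⟩ := hX
    obtain ⟨n, hn⟩ := hs U hU X hXU
    exact ⟨n, fun m hm Y h => ⟨U, hU, hn m hm Y h⟩⟩

instance NetworkClass.instMeasurableSpace [MetricSpace Ξ] : MeasurableSpace (NetworkClass Ξ k) :=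
  borel _

instance NetworkClass.instBorelSpace [MetricSpace Ξ] : BorelSpace (NetworkClass Ξ k) := ⟨rfl⟩

/-- The invariant sigma-field `I` on `𝒢_*`: the events that do not depend on the root. -/
@[reducible] def invariantSigmaField (Ξ : Type u) [MetricSpace Ξ] : MeasurableSpace (GStar Ξ) where
  MeasurableSet' A := MeasurableSet A ∧
    ∀ (G : Network Ξ) (o v : G.V), G.cls₁ o ∈ A → G.cls₁ v ∈ A
  measurableSet_empty := ⟨MeasurableSet.empty, fun _ _ _ h => h⟩
  measurableSet_compl := fun _ hA => ⟨hA.1.compl, fun G o v h h' => h (hA.2 G v o h')⟩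
  measurableSet_iUnion := fun f hf => ⟨MeasurableSet.iUnion fun i => (hf i).1, by
    intro G o v h
    obtain ⟨i, hi⟩ := mem_iUnion.1 h
    exact mem_iUnion.2 ⟨i, (hf i).2 G o v hi⟩⟩

lemma Network.cls₁_map {G H : Network Ξ}
    (f : MarkedMultigraph.GraphIso G.toMarkedMultigraph H.toMarkedMultigraph)
    (hf : f.PreservesMarks) (o : G.V) : H.cls₁ (f.toV o) = G.cls₁ o := by
  symm
  refine Quotient.sound ⟨f, hf, fun i => ?_⟩
  fin_cases i
  rfl

lemma Network.cls₂_map {G H : Network Ξ}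
    (f : MarkedMultigraph.GraphIso G.toMarkedMultigraph H.toMarkedMultigraph)
    (hf : f.PreservesMarks) (o v : G.V) : H.cls₂ (f.toV o) (f.toV v) = G.cls₂ o v := by
  symm
  refine Quotient.sound ⟨f, hf, fun i => ?_⟩
  fin_cases i
  · rfl
  · rfl

/-- `g⁺[G, o] = ∑_{v ∈ V(G)} g[G, o, v]` -/
noncomputable def massOut (g : GStarStar Ξ → ℝ≥0) : GStar Ξ → ℝ≥0∞ :=
  Quotient.lift
    (fun X : RootedNetwork Ξ 1 => ∑' v : X.V, (g (X.toNetwork.cls₂ (X.root 0) v) : ℝ≥0∞)) (by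
      rintro X Y ⟨f, hf, h⟩
      show (∑' v : X.V, (g (X.toNetwork.cls₂ (X.root 0) v) : ℝ≥0∞)) =
        ∑' v : Y.V, (g (Y.toNetwork.cls₂ (Y.root 0) v) : ℝ≥0∞)
      rw [← Equiv.tsum_eq f.toV, ← h 0]
      exact tsum_congr fun v => by
        rw [Network.cls₂_map (G := X.toNetwork) (H := Y.toNetwork) f hf])

/-- `g⁻[G, o] = ∑_{v ∈ V(G)} g[G, v, o]` -/
noncomputable def massIn (g : GStarStar Ξ → ℝ≥0) : GStar Ξ → ℝ≥0∞ :=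
  Quotient.lift
    (fun X : RootedNetwork Ξ 1 => ∑' v : X.V, (g (X.toNetwork.cls₂ v (X.root 0)) : ℝ≥0∞)) (by
      rintro X Y ⟨f, hf, h⟩
      show (∑' v : X.V, (g (X.toNetwork.cls₂ v (X.root 0)) : ℝ≥0∞)) =
        ∑' v : Y.V, (g (Y.toNetwork.cls₂ v (Y.root 0)) : ℝ≥0∞)
      rw [← Equiv.tsum_eq f.toV, ← h 0]
      exact tsum_congr fun v => by
        rw [Network.cls₂_map (G := X.toNetwork) (H := Y.toNetwork) f hf])

/-- Unimodularity of a probability measure on `𝒢_*`: the mass transport principle. -/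
def IsUnimodular [MetricSpace Ξ] (μ : Measure (GStar Ξ)) : Prop :=
  ∀ g : GStarStar Ξ → ℝ≥0, Measurable g → ∫⁻ x, massOut g x ∂μ = ∫⁻ x, massIn g x ∂μ

end Spaces

/-! ## The stable transport algorithm

The algorithm is run on a vertex set `V` with an integer-valued distance `d` (the graph distance),
with weights `w₁` on the sites and `w₂` on the centers. -/

namespace StableTransport

variable {V : Type}

/-- The application radius of the site `x`, where `R` is the rejection function of the preceding
stage: the least `a` such that the centers within distance `a` of `x` have total remaining capacity
`∑ (w₂ ξ - R x ξ)` at least `w₁ x`, and `∞` if there is none. Distances being integers, it is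
enough to consider integer `a`. -/
noncomputable def applicationRadius (d : V → V → ℕ) (w₁ w₂ : V → ℝ) (R : V → V → ℝ) (x : V) : ℕ∞ :=
  sInf ((fun a : ℕ => (a : ℕ∞)) '' {a : ℕ | w₁ x ≤ ∑ᶠ ξ ∈ {ξ | d x ξ ≤ a}, (w₂ ξ - R x ξ)})

/-- The applications of the site `x`, with coefficient `c` on the boundary of its application
ball. -/
noncomputable def applicationWith (d : V → V → ℕ) (w₁ w₂ : V → ℝ) (R : V → V → ℝ) (x : V) (c : ℝ)
    (ξ : V) : ℝ :=
  if (d x ξ : ℕ∞) < applicationRadius d w₁ w₂ R x then w₂ ξ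
  else if (d x ξ : ℕ∞) = applicationRadius d w₁ w₂ R x then c * R x ξ + (1 - c) * w₂ ξ
  else 0

/-- The requirement on the coefficient `c` of the site `x`. -/
def IsApplicationCoeff (d : V → V → ℕ) (w₁ w₂ : V → ℝ) (R : V → V → ℝ) (x : V) (c : ℝ) : Prop :=
  c ∈ Icc (0 : ℝ) 1 ∧ HasSum (fun ξ => applicationWith d w₁ w₂ R x c ξ - R x ξ) (w₁ x)

/-- The application function; the coefficient is a chosen one satisfying the requirement. (The
coefficient has no effect if the application radius is infinite.) -/
noncomputable def application (d : V → V → ℕ) (w₁ w₂ : V → ℝ) (R : V → V → ℝ) (x ξ : V) : ℝ :=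
  applicationWith d w₁ w₂ R x (Classical.epsilon (IsApplicationCoeff d w₁ w₂ R x)) ξ

/-- The rejection radius of the center `ξ`, where `A` is the application function of the same
stage. -/
noncomputable def rejectionRadius (d : V → V → ℕ) (w₂ : V → ℝ) (A : V → V → ℝ) (ξ : V) : ℕ∞ :=
  sInf ((fun r : ℕ => (r : ℕ∞)) '' {r : ℕ | w₂ ξ ≤ ∑ᶠ x ∈ {x | d x ξ ≤ r}, A x ξ})

/-- The rejections by the center `ξ`, with coefficient `c` on the boundary of its rejection ball. -/
noncomputable def rejectionWith (d : V → V → ℕ) (w₂ : V → ℝ) (A : V → V → ℝ) (ξ : V) (c : ℝ)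
    (x : V) : ℝ :=
  if (d x ξ : ℕ∞) < rejectionRadius d w₂ A ξ then 0
  else if (d x ξ : ℕ∞) = rejectionRadius d w₂ A ξ then c * A x ξ
  else A x ξ

/-- The requirement on the coefficient `c` of the center `ξ`. -/
def IsRejectionCoeff (d : V → V → ℕ) (w₂ : V → ℝ) (A : V → V → ℝ) (ξ : V) (c : ℝ) : Prop :=
  c ∈ Icc (0 : ℝ) 1 ∧ HasSum (fun x => A x ξ - rejectionWith d w₂ A ξ c x) (w₂ ξ)

/-- The rejection function; the coefficient is a chosen one satisfying the requirement. (The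
coefficient has no effect if the rejection radius is infinite.) -/
noncomputable def rejection (d : V → V → ℕ) (w₂ : V → ℝ) (A : V → V → ℝ) (x ξ : V) : ℝ :=
  rejectionWith d w₂ A ξ (Classical.epsilon (IsRejectionCoeff d w₂ A ξ)) x

/-- `R n x ξ` is the mass which the center `ξ` has rejected from the site `x` after stage `n`;
`R 0 = 0`. -/
noncomputable def R (d : V → V → ℕ) (w₁ w₂ : V → ℝ) : ℕ → V → V → ℝ
  | 0 => fun _ _ => 0
  | n + 1 => rejection d w₂ (application d w₁ w₂ (R d w₁ w₂ n))

/-- `A n x ξ` is the mass which the site `x` applies to the center `ξ` at stage `n + 1`. -/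
noncomputable def A (d : V → V → ℕ) (w₁ w₂ : V → ℝ) (n : ℕ) : V → V → ℝ :=
  application d w₁ w₂ (R d w₁ w₂ n)

/-- The resulting transport: the limit of the applications minus the limit of the rejections. -/
noncomputable def T (d : V → V → ℕ) (w₁ w₂ : V → ℝ) (x ξ : V) : ℝ :=
  limUnder atTop (fun n => A d w₁ w₂ n x ξ) - limUnder atTop (fun n => R d w₁ w₂ n x ξ)

/-- The algorithm is well defined: whenever a radius is finite, the required coefficient exists and
any admissible coefficient gives the same application (rejection) function, and the limits of the
applications and of the rejections exist. -/
def WellDefined (d : V → V → ℕ) (w₁ w₂ : V → ℝ) : Prop :=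
  (∀ n x, applicationRadius d w₁ w₂ (R d w₁ w₂ n) x ≠ ⊤ →
    (∃ c, IsApplicationCoeff d w₁ w₂ (R d w₁ w₂ n) x c) ∧
      ∀ c, IsApplicationCoeff d w₁ w₂ (R d w₁ w₂ n) x c →
        A d w₁ w₂ n x = applicationWith d w₁ w₂ (R d w₁ w₂ n) x c) ∧
  (∀ n ξ, rejectionRadius d w₂ (A d w₁ w₂ n) ξ ≠ ⊤ →
    (∃ c, IsRejectionCoeff d w₂ (A d w₁ w₂ n) ξ c) ∧
      ∀ c, IsRejectionCoeff d w₂ (A d w₁ w₂ n) ξ c →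
        (fun x => R d w₁ w₂ (n + 1) x ξ) = rejectionWith d w₂ (A d w₁ w₂ n) ξ c) ∧
  ∀ x ξ, (∃ a, Tendsto (fun n => A d w₁ w₂ n x ξ) atTop (𝓝 a)) ∧
    ∃ r, Tendsto (fun n => R d w₁ w₂ n x ξ) atTop (𝓝 r)

/-! The algorithm commutes with isomorphisms. -/

section Invariance

variable {V' : Type} {d : V → V → ℕ} {d' : V' → V' → ℕ} {w₁ w₂ : V → ℝ} {w₁' w₂' : V' → ℝ}

lemma applicationRadius_map (e : V ≃ V') (hd : ∀ x y, d' (e x) (e y) = d x y)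
    (h₁ : ∀ x, w₁' (e x) = w₁ x) (h₂ : ∀ x, w₂' (e x) = w₂ x) {R : V → V → ℝ} {R' : V' → V' → ℝ}
    (hR : ∀ x y, R' (e x) (e y) = R x y) (x : V) :
    applicationRadius d' w₁' w₂' R' (e x) = applicationRadius d w₁ w₂ R x := by
  unfold applicationRadius
  congr 2
  ext a
  simp only [mem_ofPred_eq, h₁]
  rw [← finsum_comp_equiv e]
  simp only [hd, h₂, hR]

lemma applicationWith_map (e : V ≃ V') (hd : ∀ x y, d' (e x) (e y) = d x y)
    (h₁ : ∀ x, w₁' (e x) = w₁ x) (h₂ : ∀ x, w₂' (e x) = w₂ x) {R : V → V → ℝ} {R' : V' → V' → ℝ}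
    (hR : ∀ x y, R' (e x) (e y) = R x y) (x : V) (c : ℝ) (ξ : V) :
    applicationWith d' w₁' w₂' R' (e x) c (e ξ) = applicationWith d w₁ w₂ R x c ξ := by
  unfold applicationWith
  rw [applicationRadius_map e hd h₁ h₂ hR, hd, h₂, hR]

lemma application_map (e : V ≃ V') (hd : ∀ x y, d' (e x) (e y) = d x y)
    (h₁ : ∀ x, w₁' (e x) = w₁ x) (h₂ : ∀ x, w₂' (e x) = w₂ x) {R : V → V → ℝ} {R' : V' → V' → ℝ}
    (hR : ∀ x y, R' (e x) (e y) = R x y) (x ξ : V) :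
    application d' w₁' w₂' R' (e x) (e ξ) = application d w₁ w₂ R x ξ := by
  unfold application
  have : IsApplicationCoeff d' w₁' w₂' R' (e x) = IsApplicationCoeff d w₁ w₂ R x := by
    funext c
    unfold IsApplicationCoeff
    rw [← e.hasSum_iff, h₁]
    simp only [Function.comp_def, applicationWith_map e hd h₁ h₂ hR, hR]
  rw [this, applicationWith_map e hd h₁ h₂ hR]

lemma rejectionRadius_map (e : V ≃ V') (hd : ∀ x y, d' (e x) (e y) = d x y)
    (h₂ : ∀ x, w₂' (e x) = w₂ x) {A : V → V → ℝ} {A' : V' → V' → ℝ}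
    (hA : ∀ x y, A' (e x) (e y) = A x y) (ξ : V) :
    rejectionRadius d' w₂' A' (e ξ) = rejectionRadius d w₂ A ξ := by
  unfold rejectionRadius
  congr 2
  ext r
  simp only [mem_ofPred_eq, h₂]
  rw [← finsum_comp_equiv e]
  simp only [hd, hA]

lemma rejectionWith_map (e : V ≃ V') (hd : ∀ x y, d' (e x) (e y) = d x y)
    (h₂ : ∀ x, w₂' (e x) = w₂ x) {A : V → V → ℝ} {A' : V' → V' → ℝ}
    (hA : ∀ x y, A' (e x) (e y) = A x y) (ξ : V) (c : ℝ) (x : V) :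
    rejectionWith d' w₂' A' (e ξ) c (e x) = rejectionWith d w₂ A ξ c x := by
  unfold rejectionWith
  rw [rejectionRadius_map e hd h₂ hA, hd, hA]

lemma rejection_map (e : V ≃ V') (hd : ∀ x y, d' (e x) (e y) = d x y)
    (h₂ : ∀ x, w₂' (e x) = w₂ x) {A : V → V → ℝ} {A' : V' → V' → ℝ}
    (hA : ∀ x y, A' (e x) (e y) = A x y) (x ξ : V) :
    rejection d' w₂' A' (e x) (e ξ) = rejection d w₂ A x ξ := by
  unfold rejection
  have : IsRejectionCoeff d' w₂' A' (e ξ) = IsRejectionCoeff d w₂ A ξ := by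
    funext c
    unfold IsRejectionCoeff
    rw [← e.hasSum_iff, h₂]
    simp only [Function.comp_def, rejectionWith_map e hd h₂ hA, hA]
  rw [this, rejectionWith_map e hd h₂ hA]

lemma R_map (e : V ≃ V') (hd : ∀ x y, d' (e x) (e y) = d x y)
    (h₁ : ∀ x, w₁' (e x) = w₁ x) (h₂ : ∀ x, w₂' (e x) = w₂ x) (n : ℕ) :
    ∀ x ξ, R d' w₁' w₂' n (e x) (e ξ) = R d w₁ w₂ n x ξ := by
  induction n with
  | zero => exact fun _ _ => rfl
  | succ n ih => exact fun x ξ => rejection_map e hd h₂ (application_map e hd h₁ h₂ ih) x ξ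

lemma T_map (e : V ≃ V') (hd : ∀ x y, d' (e x) (e y) = d x y)
    (h₁ : ∀ x, w₁' (e x) = w₁ x) (h₂ : ∀ x, w₂' (e x) = w₂ x) (x ξ : V) :
    T d' w₁' w₂' (e x) (e ξ) = T d w₁ w₂ x ξ := by
  unfold T A
  simp only [R_map e hd h₁ h₂, fun n => application_map e hd h₁ h₂ (R_map e hd h₁ h₂ n)]

end Invariance

end StableTransport

section Transport

universe u
variable {Ξ : Type u}

/-- The transport `T_G(x, ξ)` produced by the algorithm on the network `G`, for the weights
`w₁[G, ·]` on the sites and `w₂[G, ·]` on the centers. -/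
noncomputable def Network.stableTransport (G : Network Ξ) (w₁ w₂ : GStar Ξ → ℝ≥0) (x ξ : G.V) : ℝ :=
  StableTransport.T G.graph.dist (fun v => (w₁ (G.cls₁ v) : ℝ)) (fun v => (w₂ (G.cls₁ v) : ℝ)) x ξ

lemma Network.stableTransport_map {G H : Network Ξ} (w₁ w₂ : GStar Ξ → ℝ≥0)
    (f : MarkedMultigraph.GraphIso G.toMarkedMultigraph H.toMarkedMultigraph)
    (hf : f.PreservesMarks) (x ξ : G.V) :
    H.stableTransport w₁ w₂ (f.toV x) (f.toV ξ) = G.stableTransport w₁ w₂ x ξ := by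
  unfold Network.stableTransport
  exact StableTransport.T_map f.toV (f.dist_eq G.connected H.connected)
    (fun v => by rw [Network.cls₁_map f hf]) (fun v => by rw [Network.cls₁_map f hf]) x ξ

/-- The function `T` on `𝒢_**` given by `T[G, x, ξ] = T_G(x, ξ)`. -/
noncomputable def stableKernel (w₁ w₂ : GStar Ξ → ℝ≥0) : GStarStar Ξ → ℝ :=
  Quotient.lift
    (fun X : RootedNetwork Ξ 2 => X.toNetwork.stableTransport w₁ w₂ (X.root 0) (X.root 1)) (by
      rintro X Y ⟨f, hf, h⟩
      show X.toNetwork.stableTransport w₁ w₂ (X.root 0) (X.root 1) =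
        Y.toNetwork.stableTransport w₁ w₂ (Y.root 0) (Y.root 1)
      rw [← h 0, ← h 1]
      exact (Network.stableTransport_map (G := X.toNetwork) (H := Y.toNetwork) w₁ w₂ f hf _ _).symm)

end Transport

/-! Every stage of the algorithm is a greedy filling. A site `x` fills the remaining capacities `w₂
- R_{n-1}(x, ·)` in order of distance until `w₁ x` is used up, and `A_n(x, ·)` is `R_{n-1}(x, ·)`
plus this filling. A center `ξ` keeps a filling of `A_n(·, ξ)` by the mass `w₂ ξ` and rejects the
rest. What a filling leaves over is monotone in the capacities (`sub_fill_mono`); hence `A_n` and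
`R_n` increase with `n`, are bounded by `w₂ ξ`, and converge.

On every network `T⁺ ≤ w₁` and `T⁻ ≤ w₂`, and one of the two is an equality at all vertices
(`hasSum_T_left_or_right`). Indeed, if a site `x` does not place all its mass, then every ball
around `x` has too little remaining capacity at some stage. From then on `x` applies to each center
`ξ` in that ball with the full amount `w₂ ξ`, so that `ξ` is sated from within a bounded distance.

Unimodularity excludes a deficit on the other side. The event `E` that all sites are exhausted is
invariant. On `E` the mass transport principle gives `E[T⁻] = E[T⁺] = E[w₁] = E[w₂]`, which together
with `T⁻ ≤ w₂` forces `T⁻ = w₂`; on the complement the roles are exchanged. To compare finite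
integrals, one first intersects with the invariant events `E[w₁ | I] ≤ n`. Balance at the root then
extends to all vertices (`IsUnimodular.ae_forall_vertex`).

For measurability, a filling is a formula in sums over spheres around a root, and
`measurable_outSum` makes such sums measurable. It rests on a semicontinuity
(`isOpen_lt_outSum_indicator`): a local isomorphism carries finitely many vertices along with their
surroundings. -/

/-! ## Greedy filling

Filling a capacity function `f` in order of increasing `D` until the total mass `w` is used up;
the mass is split proportionally on the last sphere. -/

namespace StableTransport

/-- The proportion of `f` which is used on the sphere of radius `k`. -/
noncomputable def fillRatio {V : Type} (D : V → ℕ) (f : V → ℝ) (w : ℝ) (k : ℕ) : ℝ :=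
  min 1 (max 0 (w - ∑ᶠ u ∈ {u | D u < k}, f u) / ∑ᶠ u ∈ {u | D u = k}, f u)

/-- The greedy filling of `f` by the mass `w`. -/
noncomputable def fill {V : Type} (D : V → ℕ) (f : V → ℝ) (w : ℝ) (v : V) : ℝ :=
  f v * fillRatio D f w (D v)

section Fill

variable {V : Type} {D : V → ℕ} {f g : V → ℝ} {w : ℝ}

lemma finite_lt (hD : ∀ k, {u | D u ≤ k}.Finite) (k : ℕ) : {u | D u < k}.Finite :=
  (hD k).subset fun u (h : D u < k) => (h.le : D u ≤ k)

lemma finite_eq (hD : ∀ k, {u | D u ≤ k}.Finite) (k : ℕ) : {u | D u = k}.Finite :=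
  (hD k).subset fun u (h : D u = k) => (h.le : D u ≤ k)

lemma finsum_mem_mono {s : Set V} (hs : s.Finite) (h : ∀ v, f v ≤ g v) :
    ∑ᶠ u ∈ s, f u ≤ ∑ᶠ u ∈ s, g u := by
  rw [finsum_mem_eq_finite_toFinset_sum _ hs, finsum_mem_eq_finite_toFinset_sum _ hs]
  exact Finset.sum_le_sum fun v _ => h v

lemma finsum_mem_mono_set {s t : Set V} (ht : t.Finite) (hst : s ⊆ t) (h : ∀ v, 0 ≤ f v) :
    ∑ᶠ u ∈ s, f u ≤ ∑ᶠ u ∈ t, f u := by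
  rw [finsum_mem_eq_finite_toFinset_sum _ ht, finsum_mem_eq_finite_toFinset_sum _ (ht.subset hst)]
  exact Finset.sum_le_sum_of_subset_of_nonneg (by simpa using hst) fun v _ _ => h v

lemma le_finsum_mem {s : Set V} (hs : s.Finite) (h : ∀ v, 0 ≤ f v) {v : V} (hv : v ∈ s) :
    f v ≤ ∑ᶠ u ∈ s, f u := by
  rw [finsum_mem_eq_finite_toFinset_sum _ hs]
  exact Finset.single_le_sum (fun v _ => h v) (by simpa using hv)

lemma finsum_ball_eq (hD : ∀ k, {u | D u ≤ k}.Finite) (f : V → ℝ) (k : ℕ) :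
    ∑ᶠ u ∈ {u | D u ≤ k}, f u = ∑ᶠ u ∈ {u | D u < k}, f u + ∑ᶠ u ∈ {u | D u = k}, f u := by
  rw [← finsum_mem_union _ (finite_lt hD k) (finite_eq hD k)]
  · congr! 3 with u
    simp [le_iff_lt_or_eq]
  · rw [Set.disjoint_left]
    intro u h h'
    simp at h h'
    omega

lemma hasSum_of_ball (hD : ∀ k, {u | D u ≤ k}.Finite) {k : ℕ} (h : ∀ v, k < D v → f v = 0) :
    HasSum f (∑ᶠ u ∈ {u | D u ≤ k}, f u) := by
  rw [finsum_mem_eq_finite_toFinset_sum _ (hD k)]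
  exact hasSum_sum_of_ne_finset_zero fun v hv => h v (by simpa using hv)

lemma fillRatio_nonneg (hf : ∀ v, 0 ≤ f v) (k : ℕ) : 0 ≤ fillRatio D f w k :=
  le_min zero_le_one (div_nonneg (le_max_left _ _) (finsum_nonneg fun v => finsum_nonneg fun _ => hf v))

lemma fillRatio_le_one (k : ℕ) : fillRatio D f w k ≤ 1 := min_le_left _ _

lemma fill_nonneg (hf : ∀ v, 0 ≤ f v) (v : V) : 0 ≤ fill D f w v :=
  mul_nonneg (hf v) (fillRatio_nonneg hf _)

lemma fill_le (hf : ∀ v, 0 ≤ f v) (v : V) : fill D f w v ≤ f v :=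
  mul_le_of_le_one_right (hf v) (fillRatio_le_one _)

lemma fill_eq_zero (v : V) (h : w ≤ ∑ᶠ u ∈ {u | D u < D v}, f u) : fill D f w v = 0 := by
  unfold fill fillRatio
  rw [max_eq_left (by linarith)]
  simp

lemma fill_eq_self (hD : ∀ k, {u | D u ≤ k}.Finite) (hf : ∀ v, 0 ≤ f v) (v : V)
    (h : ∑ᶠ u ∈ {u | D u ≤ D v}, f u ≤ w) : fill D f w v = f v := by
  unfold fill fillRatio
  have h1 : f v ≤ ∑ᶠ u ∈ {u | D u = D v}, f u := le_finsum_mem (finite_eq hD _) hf rfl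
  rw [finsum_ball_eq hD] at h
  rcases (hf v).eq_or_lt with h0 | h0
  -- The sphere may have total capacity zero here, and then the ratio has the junk value `0`; it is
  -- multiplied by `f v = 0`.
  · simp [← h0]
  · rw [min_eq_left, mul_one]
    rw [le_div_iff₀ (by linarith)]
    exact le_max_of_le_right (by linarith)

/-- What is left over is monotone in the capacities. -/
lemma sub_fill_mono (hD : ∀ k, {u | D u ≤ k}.Finite) (hf : ∀ v, 0 ≤ f v) (hfg : ∀ v, f v ≤ g v)
    (v : V) : f v - fill D f w v ≤ g v - fill D g w v := by
  have hg : ∀ v, 0 ≤ g v := fun v => (hf v).trans (hfg v)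
  rcases (hf v).eq_or_lt with h0 | h0
  · have := fill_le (w := w) (D := D) hg v
    have h2 : fill D f w v = 0 := by unfold fill; rw [← h0, zero_mul]
    linarith
  · have h1 : f v ≤ ∑ᶠ u ∈ {u | D u = D v}, f u := le_finsum_mem (finite_eq hD _) hf rfl
    -- Larger capacities leave less mass for the sphere and spread it over a larger total, so the
    -- ratio decreases. The assumption `0 < f v` keeps the denominator positive, which excludes the
    -- junk value of `0 / 0`.
    have key : fillRatio D g w (D v) ≤ fillRatio D f w (D v) := by
      unfold fillRatio
      refine min_le_min_left 1 (div_le_div₀ (le_max_left _ _) (max_le_max_left 0 ?_)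
        (by linarith) (finsum_mem_mono (finite_eq hD _) hfg))
      exact sub_le_sub_left (finsum_mem_mono (finite_lt hD _) hfg) _
    have h2 := fillRatio_le_one (D := D) (f := f) (w := w) (D v)
    unfold fill
    nlinarith [hfg v, hf v]

/-- Sphere by sphere: if the open ball has capacity `p` and the sphere has capacity `q`, then the
sphere receives `min q (max 0 (w - p))`, and adding this to `min w p` gives `min w (p + q)`. -/
lemma finsum_ball_fill (hD : ∀ k, {u | D u ≤ k}.Finite) (hf : ∀ v, 0 ≤ f v) (hw : 0 ≤ w) (k : ℕ) :
    ∑ᶠ u ∈ {u | D u ≤ k}, fill D f w u = min w (∑ᶠ u ∈ {u | D u ≤ k}, f u) := by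
  have sphere : ∀ k, ∑ᶠ u ∈ {u | D u = k}, fill D f w u =
      min (∑ᶠ u ∈ {u | D u = k}, f u) (max 0 (w - ∑ᶠ u ∈ {u | D u < k}, f u)) := by
    intro k
    have h1 : ∑ᶠ u ∈ {u | D u = k}, fill D f w u =
        (∑ᶠ u ∈ {u | D u = k}, f u) * fillRatio D f w k := by
      rw [finsum_mem_eq_finite_toFinset_sum _ (finite_eq hD k),
        finsum_mem_eq_finite_toFinset_sum _ (finite_eq hD k), Finset.sum_mul]
      refine Finset.sum_congr rfl fun v hv => ?_
      have : D v = k := by simpa using hv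
      rw [fill, this]
    have h0 : 0 ≤ ∑ᶠ u ∈ {u | D u = k}, f u :=
      finsum_nonneg fun v => finsum_nonneg fun _ => hf v
    rw [h1, fillRatio, mul_min_of_nonneg _ _ h0, mul_one]
    rcases h0.eq_or_lt with h | h
    · rw [← h]; simp
    · rw [mul_div_cancel₀ _ h.ne']
  have step : ∀ k, ∑ᶠ u ∈ {u | D u < k}, fill D f w u = min w (∑ᶠ u ∈ {u | D u < k}, f u) →
      ∑ᶠ u ∈ {u | D u ≤ k}, fill D f w u = min w (∑ᶠ u ∈ {u | D u ≤ k}, f u) := by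
    intro k h
    rw [finsum_ball_eq hD, finsum_ball_eq hD, h, sphere]
    have h0 : 0 ≤ ∑ᶠ u ∈ {u | D u = k}, f u :=
      finsum_nonneg fun v => finsum_nonneg fun _ => hf v
    generalize ∑ᶠ u ∈ {u | D u = k}, f u = q at h0
    generalize ∑ᶠ u ∈ {u | D u < k}, f u = p
    rcases le_total w p with h1 | h1
    · rw [min_eq_left h1, max_eq_left (by linarith), min_eq_right h0, min_eq_left (by linarith),
        add_zero]
    · rw [min_eq_right h1, max_eq_right (by linarith), ← min_add_add_left, add_sub_cancel,
        min_comm]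
  induction k with
  | zero => exact step 0 (by simpa using hw)
  | succ k ih =>
    apply step
    simpa only [Nat.lt_succ_iff] using ih

lemma fill_eq_zero_of_ball (hD : ∀ k, {u | D u ≤ k}.Finite) (hf : ∀ v, 0 ≤ f v) {k : ℕ}
    (h : w ≤ ∑ᶠ u ∈ {u | D u ≤ k}, f u) {v : V} (hv : k < D v) : fill D f w v = 0 :=
  fill_eq_zero v (h.trans (finsum_mem_mono_set (finite_lt hD _)
    (fun _ hu => lt_of_le_of_lt hu hv) hf))

lemma hasSum_fill (hD : ∀ k, {u | D u ≤ k}.Finite) (hf : ∀ v, 0 ≤ f v) (hw : 0 ≤ w) {k : ℕ}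
    (h : w ≤ ∑ᶠ u ∈ {u | D u ≤ k}, f u) : HasSum (fill D f w) w := by
  have := hasSum_of_ball hD (f := fill D f w) fun v hv => fill_eq_zero_of_ball hD hf h hv
  rwa [finsum_ball_fill hD hf hw, min_eq_left h] at this

lemma sum_fill_le (hD : ∀ k, {u | D u ≤ k}.Finite) (hf : ∀ v, 0 ≤ f v) (hw : 0 ≤ w)
    (s : Finset V) : ∑ v ∈ s, fill D f w v ≤ w := by
  obtain ⟨k, hk⟩ : ∃ k, ∀ v ∈ s, D v ≤ k := ⟨s.sup D, fun v hv => Finset.le_sup hv⟩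
  calc ∑ v ∈ s, fill D f w v = ∑ᶠ v ∈ (s : Set V), fill D f w v := (finsum_mem_coe_finset _ _).symm
    _ ≤ ∑ᶠ u ∈ {u | D u ≤ k}, fill D f w u :=
      finsum_mem_mono_set (hD k) hk (fill_nonneg hf)
    _ ≤ w := by rw [finsum_ball_fill hD hf hw]; exact min_le_left _ _

/-- The least radius at which the capacity is at least `w`, and `∞` if there is none. -/
noncomputable def fillRadius (D : V → ℕ) (f : V → ℝ) (w : ℝ) : ℕ∞ :=
  sInf ((fun a : ℕ => (a : ℕ∞)) '' {a : ℕ | w ≤ ∑ᶠ u ∈ {u | D u ≤ a}, f u})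

lemma lt_of_lt_fillRadius {k : ℕ} (h : (k : ℕ∞) < fillRadius D f w) :
    ∑ᶠ u ∈ {u | D u ≤ k}, f u < w := by
  by_contra! hc
  exact absurd (sInf_le ⟨k, hc, rfl⟩ : fillRadius D f w ≤ k) (not_le.2 h)

lemma le_of_fillRadius_le (hD : ∀ k, {u | D u ≤ k}.Finite) (hf : ∀ v, 0 ≤ f v) {k : ℕ}
    (h : fillRadius D f w ≤ k) : w ≤ ∑ᶠ u ∈ {u | D u ≤ k}, f u := by
  by_contra! hc
  have : ((k + 1 : ℕ) : ℕ∞) ≤ fillRadius D f w := by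
    refine le_sInf ?_
    rintro _ ⟨a, ha, rfl⟩
    simp only [Nat.cast_le]
    by_contra! hak
    exact absurd (ha.trans (finsum_mem_mono_set (hD k)
      (fun u hu => le_trans hu (Nat.lt_succ_iff.1 hak)) hf)) (not_le.2 hc)
  have := this.trans h
  rw [Nat.cast_le] at this
  omega

lemma fillRadius_anti (hD : ∀ k, {u | D u ≤ k}.Finite) (hfg : ∀ v, f v ≤ g v) :
    fillRadius D g w ≤ fillRadius D f w := by
  refine sInf_le_sInf (image_mono fun a ha => ?_)
  exact le_trans ha (finsum_mem_mono (hD a) hfg)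

lemma fill_of_lt_fillRadius (hD : ∀ k, {u | D u ≤ k}.Finite) (hf : ∀ v, 0 ≤ f v) {v : V}
    (h : (D v : ℕ∞) < fillRadius D f w) : fill D f w v = f v :=
  fill_eq_self hD hf v (lt_of_lt_fillRadius h).le

lemma fill_of_fillRadius_lt (hD : ∀ k, {u | D u ≤ k}.Finite) (hf : ∀ v, 0 ≤ f v) {v : V}
    (h : fillRadius D f w < D v) : fill D f w v = 0 := by
  obtain ⟨a, ha⟩ := ENat.ne_top_iff_exists.1 h.ne_top
  refine fill_eq_zero_of_ball hD hf (k := a) (le_of_fillRadius_le hD hf ha.ge) ?_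
  rw [← ha] at h
  exact_mod_cast h

/-- A filling which is proportional to `f` with coefficient `c` on the last sphere. -/
noncomputable def fillWith (D : V → ℕ) (f : V → ℝ) (w : ℝ) (c : ℝ) (v : V) : ℝ :=
  if (D v : ℕ∞) < fillRadius D f w then f v
  else if (D v : ℕ∞) = fillRadius D f w then c * f v
  else 0

lemma fillWith_of_top (hD : ∀ k, {u | D u ≤ k}.Finite) (hf : ∀ v, 0 ≤ f v)
    (h : fillRadius D f w = ⊤) (c : ℝ) : fillWith D f w c = fill D f w := by
  funext v
  have : (D v : ℕ∞) < fillRadius D f w := by rw [h]; exact ENat.natCast_lt_top _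
  rw [fill_of_lt_fillRadius hD hf this, fillWith, if_pos this]

/-- At a finite radius the coefficient is the fill ratio of the last sphere. At an infinite radius
there is no last sphere and any coefficient serves. -/
lemma exists_fillWith_eq (hD : ∀ k, {u | D u ≤ k}.Finite) (hf : ∀ v, 0 ≤ f v) :
    ∃ c ∈ Icc (0 : ℝ) 1, fillWith D f w c = fill D f w := by
  by_cases h : fillRadius D f w = ⊤
  · exact ⟨0, by simp, fillWith_of_top hD hf h 0⟩
  obtain ⟨a, ha⟩ := ENat.ne_top_iff_exists.1 h
  refine ⟨fillRatio D f w a, ⟨fillRatio_nonneg hf _, fillRatio_le_one _⟩, ?_⟩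
  funext v
  unfold fillWith
  split_ifs with h1 h2
  · exact (fill_of_lt_fillRadius hD hf h1).symm
  · rw [← ha, Nat.cast_inj] at h2
    rw [fill, h2, mul_comm]
  · exact (fill_of_fillRadius_lt hD hf (lt_of_le_of_ne (not_lt.1 h1) (Ne.symm h2))).symm

lemma hasSum_fill_of_ne_top (hD : ∀ k, {u | D u ≤ k}.Finite) (hf : ∀ v, 0 ≤ f v) (hw : 0 ≤ w)
    (h : fillRadius D f w ≠ ⊤) : HasSum (fill D f w) w := by
  obtain ⟨a, ha⟩ := ENat.ne_top_iff_exists.1 h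
  exact hasSum_fill hD hf hw (le_of_fillRadius_le hD hf ha.ge)

/-- The coefficient itself need not be unique, since `f` may vanish on the last sphere. But
`fillWith` is pointwise monotone in the coefficient, and two comparable functions with the same
finite sum coincide. -/
lemma fillWith_eq_of_hasSum (hD : ∀ k, {u | D u ≤ k}.Finite) (hf : ∀ v, 0 ≤ f v) (hw : 0 ≤ w)
    (h : fillRadius D f w ≠ ⊤) {c : ℝ} (hc : HasSum (fillWith D f w c) w) :
    fillWith D f w c = fill D f w := by
  obtain ⟨c', -, hc'⟩ := exists_fillWith_eq (w := w) hD hf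
  have hs := hasSum_fill_of_ne_top hD hf hw h
  rw [← hc'] at hs ⊢
  rcases le_total c c' with hle | hle
  · have hmono : ∀ v, fillWith D f w c v ≤ fillWith D f w c' v := fun v => by
      unfold fillWith
      split_ifs
      exacts [le_rfl, mul_le_mul_of_nonneg_right hle (hf v), le_rfl]
    have := (hasSum_zero_iff_of_nonneg (fun v => sub_nonneg.2 (hmono v))).1
      (by simpa using hs.sub hc)
    funext v
    have := congrFun this v
    simp only [Pi.zero_apply] at this
    linarith
  · have hmono : ∀ v, fillWith D f w c' v ≤ fillWith D f w c v := fun v => by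
      unfold fillWith
      split_ifs
      exacts [le_rfl, mul_le_mul_of_nonneg_right hle (hf v), le_rfl]
    have := (hasSum_zero_iff_of_nonneg (fun v => sub_nonneg.2 (hmono v))).1
      (by simpa using hc.sub hs)
    funext v
    have := congrFun this v
    simp only [Pi.zero_apply] at this
    linarith

end Fill

end StableTransport

/-! ## The stable transport algorithm in terms of greedy filling -/

namespace StableTransport

section Stages

variable {V : Type} {d : V → V → ℕ} {w₁ w₂ : V → ℝ} {R' A' : V → V → ℝ}

/-- The properties of a rejection function that make the next stage well defined. -/
structure IsAdmissible (d : V → V → ℕ) (w₁ w₂ : V → ℝ) (R' : V → V → ℝ) : Prop where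
  nonneg : ∀ x ξ, 0 ≤ R' x ξ
  le : ∀ x ξ, R' x ξ ≤ w₂ ξ
  eq_zero : ∀ x ξ, applicationRadius d w₁ w₂ R' x < d x ξ → R' x ξ = 0

/-- On the boundary sphere, `c R + (1 - c) w₂ = R + (1 - c) (w₂ - R)`. Beyond the radius
applications are zero, which agrees with `R'` plus a filling only because of `IsAdmissible.eq_zero`.
-/
lemma applicationWith_eq (hR : IsAdmissible d w₁ w₂ R') (x : V) (c : ℝ) (ξ : V) :
    applicationWith d w₁ w₂ R' x c ξ =
      R' x ξ + fillWith (d x) (fun ξ => w₂ ξ - R' x ξ) (w₁ x) (1 - c) ξ := by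
  unfold applicationWith fillWith
  -- The application radius is by definition the `fillRadius` of the remaining capacities.
  change ite ((d x ξ : ℕ∞) < applicationRadius d w₁ w₂ R' x) _ _ =
    _ + ite ((d x ξ : ℕ∞) < applicationRadius d w₁ w₂ R' x) _
      (ite ((d x ξ : ℕ∞) = applicationRadius d w₁ w₂ R' x) _ _)
  split_ifs with h1 h2
  · ring
  · ring
  · rw [hR.eq_zero x ξ (lt_of_le_of_ne (not_lt.1 h1) (Ne.symm h2)), add_zero]

lemma isApplicationCoeff_iff (hR : IsAdmissible d w₁ w₂ R') (x : V) (c : ℝ) :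
    IsApplicationCoeff d w₁ w₂ R' x c ↔ c ∈ Icc (0 : ℝ) 1 ∧
      HasSum (fillWith (d x) (fun ξ => w₂ ξ - R' x ξ) (w₁ x) (1 - c)) (w₁ x) := by
  unfold IsApplicationCoeff
  simp only [applicationWith_eq hR, add_sub_cancel_left]

lemma exists_applicationCoeff (hd : ∀ x k, {ξ | d x ξ ≤ k}.Finite) (h₁ : ∀ x, 0 ≤ w₁ x)
    (hR : IsAdmissible d w₁ w₂ R') (x : V) (h : applicationRadius d w₁ w₂ R' x ≠ ⊤) :
    ∃ c, IsApplicationCoeff d w₁ w₂ R' x c := by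
  have hf : ∀ ξ, 0 ≤ w₂ ξ - R' x ξ := fun ξ => sub_nonneg.2 (hR.le x ξ)
  obtain ⟨c, hc, hc'⟩ := exists_fillWith_eq (w := w₁ x) (hd x) hf
  refine ⟨1 - c, (isApplicationCoeff_iff hR x _).2 ⟨⟨by linarith [hc.2], by linarith [hc.1]⟩, ?_⟩⟩
  rw [sub_sub_cancel, hc']
  exact hasSum_fill_of_ne_top (hd x) hf (h₁ x) h

/-- The requirement on `c` is conditional on a finite radius, so that the lemma also covers the
arbitrary value which `Classical.epsilon` returns when no coefficient is needed. -/
lemma applicationWith_eq_fill (hd : ∀ x k, {ξ | d x ξ ≤ k}.Finite) (h₁ : ∀ x, 0 ≤ w₁ x)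
    (hR : IsAdmissible d w₁ w₂ R') (x : V) {c : ℝ}
    (h : applicationRadius d w₁ w₂ R' x ≠ ⊤ → IsApplicationCoeff d w₁ w₂ R' x c) (ξ : V) :
    applicationWith d w₁ w₂ R' x c ξ =
      R' x ξ + fill (d x) (fun ξ => w₂ ξ - R' x ξ) (w₁ x) ξ := by
  have hf : ∀ ξ, 0 ≤ w₂ ξ - R' x ξ := fun ξ => sub_nonneg.2 (hR.le x ξ)
  rw [applicationWith_eq hR]
  by_cases ht : applicationRadius d w₁ w₂ R' x = ⊤
  · rw [fillWith_of_top (hd x) hf ht]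
  · rw [fillWith_eq_of_hasSum (hd x) hf (h₁ x) ht ((isApplicationCoeff_iff hR x c).1 (h ht)).2]

lemma application_eq_fill (hd : ∀ x k, {ξ | d x ξ ≤ k}.Finite) (h₁ : ∀ x, 0 ≤ w₁ x)
    (hR : IsAdmissible d w₁ w₂ R') (x ξ : V) :
    application d w₁ w₂ R' x ξ = R' x ξ + fill (d x) (fun ξ => w₂ ξ - R' x ξ) (w₁ x) ξ :=
  applicationWith_eq_fill hd h₁ hR x
    (fun h => Classical.epsilon_spec (exists_applicationCoeff hd h₁ hR x h)) ξ

/-- The mass that a center keeps is a filling of the applications, with `1 - c` on the last sphere.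
Beyond the radius everything is rejected, so no admissibility is needed. -/
lemma rejectionWith_eq (ξ : V) (c : ℝ) (x : V) :
    rejectionWith d w₂ A' ξ c x =
      A' x ξ - fillWith (fun x => d x ξ) (fun x => A' x ξ) (w₂ ξ) (1 - c) x := by
  unfold rejectionWith fillWith
  change ite ((d x ξ : ℕ∞) < rejectionRadius d w₂ A' ξ) _ _ =
    _ - ite ((d x ξ : ℕ∞) < rejectionRadius d w₂ A' ξ) _
      (ite ((d x ξ : ℕ∞) = rejectionRadius d w₂ A' ξ) _ _)
  split_ifs with h1 h2 <;> ring

lemma isRejectionCoeff_iff (ξ : V) (c : ℝ) :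
    IsRejectionCoeff d w₂ A' ξ c ↔ c ∈ Icc (0 : ℝ) 1 ∧
      HasSum (fillWith (fun x => d x ξ) (fun x => A' x ξ) (w₂ ξ) (1 - c)) (w₂ ξ) := by
  unfold IsRejectionCoeff
  simp only [rejectionWith_eq, sub_sub_cancel]

lemma exists_rejectionCoeff (hd : ∀ ξ k, {x | d x ξ ≤ k}.Finite) (h₂ : ∀ ξ, 0 ≤ w₂ ξ)
    (hA : ∀ x ξ, 0 ≤ A' x ξ) (ξ : V) (h : rejectionRadius d w₂ A' ξ ≠ ⊤) :
    ∃ c, IsRejectionCoeff d w₂ A' ξ c := by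
  obtain ⟨c, hc, hc'⟩ := exists_fillWith_eq (w := w₂ ξ) (hd ξ) (fun x => hA x ξ)
  refine ⟨1 - c, (isRejectionCoeff_iff ξ _).2 ⟨⟨by linarith [hc.2], by linarith [hc.1]⟩, ?_⟩⟩
  rw [sub_sub_cancel, hc']
  exact hasSum_fill_of_ne_top (hd ξ) (fun x => hA x ξ) (h₂ ξ) h

lemma rejectionWith_eq_fill (hd : ∀ ξ k, {x | d x ξ ≤ k}.Finite) (h₂ : ∀ ξ, 0 ≤ w₂ ξ)
    (hA : ∀ x ξ, 0 ≤ A' x ξ) (ξ : V) {c : ℝ}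
    (h : rejectionRadius d w₂ A' ξ ≠ ⊤ → IsRejectionCoeff d w₂ A' ξ c) (x : V) :
    rejectionWith d w₂ A' ξ c x =
      A' x ξ - fill (fun x => d x ξ) (fun x => A' x ξ) (w₂ ξ) x := by
  rw [rejectionWith_eq]
  by_cases ht : rejectionRadius d w₂ A' ξ = ⊤
  · rw [fillWith_of_top (hd ξ) (fun x => hA x ξ) ht]
  · rw [fillWith_eq_of_hasSum (hd ξ) (fun x => hA x ξ) (h₂ ξ) ht
      ((isRejectionCoeff_iff ξ c).1 (h ht)).2]

lemma rejection_eq_fill (hd : ∀ ξ k, {x | d x ξ ≤ k}.Finite) (h₂ : ∀ ξ, 0 ≤ w₂ ξ)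
    (hA : ∀ x ξ, 0 ≤ A' x ξ) (x ξ : V) :
    rejection d w₂ A' x ξ = A' x ξ - fill (fun x => d x ξ) (fun x => A' x ξ) (w₂ ξ) x :=
  rejectionWith_eq_fill hd h₂ hA ξ
    (fun h => Classical.epsilon_spec (exists_rejectionCoeff hd h₂ hA ξ h)) x

end Stages

/-! ### Monotonicity, convergence and the dichotomy for the limit -/

section Algorithm

variable {V : Type} {d : V → V → ℕ} {w₁ w₂ : V → ℝ}
  (hd : ∀ x k, {ξ | d x ξ ≤ k}.Finite) (hd' : ∀ ξ k, {x | d x ξ ≤ k}.Finite)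
  (h₁ : ∀ x, 0 ≤ w₁ x) (h₂ : ∀ ξ, 0 ≤ w₂ ξ)

section

variable {R' : V → V → ℝ}

include hd h₁ in
lemma application_nonneg (hR : IsAdmissible d w₁ w₂ R') (x ξ : V) :
    0 ≤ application d w₁ w₂ R' x ξ := by
  rw [application_eq_fill hd h₁ hR]
  exact add_nonneg (hR.nonneg _ _) (fill_nonneg (fun ξ => sub_nonneg.2 (hR.le x ξ)) _)

include hd h₁ in
lemma application_le (hR : IsAdmissible d w₁ w₂ R') (x ξ : V) :
    application d w₁ w₂ R' x ξ ≤ w₂ ξ := by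
  rw [application_eq_fill hd h₁ hR]
  have := fill_le (D := d x) (w := w₁ x) (fun ξ => sub_nonneg.2 (hR.le x ξ)) ξ
  linarith

end

include hd hd' h₁ h₂ in
-- The two claims need each other. Growing rejections shrink the remaining capacities, hence enlarge
-- the application radii; this propagates `eq_zero`. Conversely, `A` is `w₂` minus what the site's
-- filling leaves over, so it grows with `R`, and the next `R` is what the center's filling of `A`
-- leaves over, so it grows too.
lemma isAdmissible_R_and_le (n : ℕ) : IsAdmissible d w₁ w₂ (R d w₁ w₂ n) ∧
    ∀ x ξ, R d w₁ w₂ n x ξ ≤ R d w₁ w₂ (n + 1) x ξ := by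
  have nonneg : ∀ n, IsAdmissible d w₁ w₂ (R d w₁ w₂ n) → ∀ x ξ, 0 ≤ R d w₁ w₂ (n + 1) x ξ := by
    intro n hn x ξ
    have hA := application_nonneg hd h₁ hn
    change 0 ≤ rejection d w₂ (application d w₁ w₂ (R d w₁ w₂ n)) x ξ
    rw [rejection_eq_fill hd' h₂ hA]
    exact sub_nonneg.2 (fill_le (fun x => hA x ξ) x)
  induction n with
  | zero =>
    have h0 : IsAdmissible d w₁ w₂ (R d w₁ w₂ 0) :=
      ⟨fun _ _ => le_rfl, fun _ ξ => h₂ ξ, fun _ _ _ => rfl⟩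
    exact ⟨h0, nonneg 0 h0⟩
  | succ n ih =>
    obtain ⟨hn, hle⟩ := ih
    have hA := application_nonneg hd h₁ hn
    have hRA : ∀ x ξ, R d w₁ w₂ (n + 1) x ξ ≤ application d w₁ w₂ (R d w₁ w₂ n) x ξ := by
      intro x ξ
      change rejection d w₂ (application d w₁ w₂ (R d w₁ w₂ n)) x ξ ≤ _
      rw [rejection_eq_fill hd' h₂ hA]
      exact sub_le_self _ (fill_nonneg (fun x => hA x ξ) x)
    have hs : IsAdmissible d w₁ w₂ (R d w₁ w₂ (n + 1)) := by
      refine ⟨nonneg n hn, fun x ξ => (hRA x ξ).trans (application_le hd h₁ hn x ξ), ?_⟩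
      intro x ξ hlt
      -- A center beyond the new radius is beyond the old one, where both `R n` and the filling
      -- vanish; nothing was applied there, hence nothing rejected.
      have hlt' : applicationRadius d w₁ w₂ (R d w₁ w₂ n) x < d x ξ :=
        lt_of_le_of_lt (fillRadius_anti (hd x) fun ξ => sub_le_sub_left (hle x ξ) _) hlt
      refine le_antisymm ((hRA x ξ).trans ?_) (nonneg n hn x ξ)
      rw [application_eq_fill hd h₁ hn, hn.eq_zero x ξ hlt',
        fill_of_fillRadius_lt (hd x) (fun ξ => sub_nonneg.2 (hn.le x ξ)) hlt', add_zero]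
    refine ⟨hs, fun x ξ => ?_⟩
    have hA' := application_nonneg hd h₁ hs
    change rejection d w₂ (application d w₁ w₂ (R d w₁ w₂ n)) x ξ ≤
      rejection d w₂ (application d w₁ w₂ (R d w₁ w₂ (n + 1))) x ξ
    rw [rejection_eq_fill hd' h₂ hA, rejection_eq_fill hd' h₂ hA']
    refine sub_fill_mono (g := fun x => application d w₁ w₂ (R d w₁ w₂ (n + 1)) x ξ) (hd' ξ)
      (fun x => hA x ξ) (fun x => ?_) x
    rw [application_eq_fill hd h₁ hn, application_eq_fill hd h₁ hs]
    have := sub_fill_mono (w := w₁ x) (hd x) (fun ξ => sub_nonneg.2 (hs.le x ξ))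
      (fun ξ => sub_le_sub_left (hle x ξ) (w₂ ξ)) ξ
    linarith

include hd hd' h₁ h₂

lemma isAdmissible_R (n : ℕ) : IsAdmissible d w₁ w₂ (R d w₁ w₂ n) :=
  (isAdmissible_R_and_le hd hd' h₁ h₂ n).1

lemma R_monotone (x ξ : V) : Monotone fun n => R d w₁ w₂ n x ξ :=
  monotone_nat_of_le_succ fun n => (isAdmissible_R_and_le hd hd' h₁ h₂ n).2 x ξ

lemma A_eq (n : ℕ) (x ξ : V) : A d w₁ w₂ n x ξ =
    R d w₁ w₂ n x ξ + fill (d x) (fun ξ => w₂ ξ - R d w₁ w₂ n x ξ) (w₁ x) ξ :=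
  application_eq_fill hd h₁ (isAdmissible_R hd hd' h₁ h₂ n) x ξ

lemma A_nonneg (n : ℕ) (x ξ : V) : 0 ≤ A d w₁ w₂ n x ξ :=
  application_nonneg hd h₁ (isAdmissible_R hd hd' h₁ h₂ n) x ξ

lemma A_le (n : ℕ) (x ξ : V) : A d w₁ w₂ n x ξ ≤ w₂ ξ :=
  application_le hd h₁ (isAdmissible_R hd hd' h₁ h₂ n) x ξ

lemma R_le (n : ℕ) (x ξ : V) : R d w₁ w₂ n x ξ ≤ w₂ ξ :=
  (isAdmissible_R hd hd' h₁ h₂ n).le x ξ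

lemma R_succ_eq (n : ℕ) (x ξ : V) : R d w₁ w₂ (n + 1) x ξ =
    A d w₁ w₂ n x ξ - fill (fun x => d x ξ) (fun x => A d w₁ w₂ n x ξ) (w₂ ξ) x :=
  rejection_eq_fill hd' h₂ (A_nonneg hd hd' h₁ h₂ n) x ξ

lemma A_monotone (x ξ : V) : Monotone fun n => A d w₁ w₂ n x ξ := by
  intro m n hmn
  simp only [A_eq hd hd' h₁ h₂]
  have := sub_fill_mono (w := w₁ x) (hd x) (fun ξ => sub_nonneg.2 (R_le hd hd' h₁ h₂ n x ξ))
    (fun ξ => sub_le_sub_left (R_monotone hd hd' h₁ h₂ x ξ hmn) (w₂ ξ)) ξ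
  linarith

lemma tendsto_A (x ξ : V) :
    Tendsto (fun n => A d w₁ w₂ n x ξ) atTop (𝓝 (⨆ n, A d w₁ w₂ n x ξ)) :=
  tendsto_atTop_ciSup (A_monotone hd hd' h₁ h₂ x ξ)
    ⟨w₂ ξ, forall_mem_range.2 fun n => A_le hd hd' h₁ h₂ n x ξ⟩

lemma tendsto_R (x ξ : V) :
    Tendsto (fun n => R d w₁ w₂ n x ξ) atTop (𝓝 (⨆ n, R d w₁ w₂ n x ξ)) :=
  tendsto_atTop_ciSup (R_monotone hd hd' h₁ h₂ x ξ)
    ⟨w₂ ξ, forall_mem_range.2 fun n => R_le hd hd' h₁ h₂ n x ξ⟩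

lemma tendsto_T (x ξ : V) :
    Tendsto (fun n => A d w₁ w₂ n x ξ - R d w₁ w₂ n x ξ) atTop (𝓝 (T d w₁ w₂ x ξ)) := by
  unfold T
  rw [(tendsto_A hd hd' h₁ h₂ x ξ).limUnder_eq, (tendsto_R hd hd' h₁ h₂ x ξ).limUnder_eq]
  exact (tendsto_A hd hd' h₁ h₂ x ξ).sub (tendsto_R hd hd' h₁ h₂ x ξ)

lemma tendsto_application_fill (x ξ : V) :
    Tendsto (fun n => fill (d x) (fun ξ => w₂ ξ - R d w₁ w₂ n x ξ) (w₁ x) ξ) atTop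
      (𝓝 (T d w₁ w₂ x ξ)) := by
  refine (tendsto_T hd hd' h₁ h₂ x ξ).congr fun n => ?_
  rw [A_eq hd hd' h₁ h₂, add_sub_cancel_left]

/-- The kept mass is `A_n - R_n` with both at the same stage, whereas the filling of the site pairs
`A_n` with the preceding rejection. The shift by one stage disappears in the limit, so `T` inherits
bounds from both sides. -/
lemma tendsto_rejection_fill (x ξ : V) :
    Tendsto (fun n => fill (fun x => d x ξ) (fun x => A d w₁ w₂ n x ξ) (w₂ ξ) x) atTop
      (𝓝 (T d w₁ w₂ x ξ)) := by
  have := (tendsto_A hd hd' h₁ h₂ x ξ).sub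
    ((tendsto_add_atTop_iff_nat 1).2 (tendsto_R hd hd' h₁ h₂ x ξ))
  unfold T
  rw [(tendsto_A hd hd' h₁ h₂ x ξ).limUnder_eq, (tendsto_R hd hd' h₁ h₂ x ξ).limUnder_eq]
  refine this.congr fun n => ?_
  rw [R_succ_eq hd hd' h₁ h₂, sub_sub_cancel]

theorem wellDefined : WellDefined d w₁ w₂ := by
  refine ⟨fun n x h => ⟨exists_applicationCoeff hd h₁ (isAdmissible_R hd hd' h₁ h₂ n) x h, ?_⟩,
    fun n ξ h => ⟨exists_rejectionCoeff hd' h₂ (A_nonneg hd hd' h₁ h₂ n) ξ h, ?_⟩,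
    fun x ξ => ⟨⟨_, tendsto_A hd hd' h₁ h₂ x ξ⟩, ⟨_, tendsto_R hd hd' h₁ h₂ x ξ⟩⟩⟩
  · intro c hc
    funext ξ
    rw [A_eq hd hd' h₁ h₂,
      applicationWith_eq_fill hd h₁ (isAdmissible_R hd hd' h₁ h₂ n) x (fun _ => hc)]
  · intro c hc
    funext x
    rw [R_succ_eq hd hd' h₁ h₂,
      rejectionWith_eq_fill hd' h₂ (A_nonneg hd hd' h₁ h₂ n) ξ (fun _ => hc)]

lemma T_nonneg (x ξ : V) : 0 ≤ T d w₁ w₂ x ξ :=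
  ge_of_tendsto' (tendsto_application_fill hd hd' h₁ h₂ x ξ) fun n =>
    fill_nonneg (fun ξ => sub_nonneg.2 (R_le hd hd' h₁ h₂ n x ξ)) ξ

lemma sum_T_le_left (x : V) (s : Finset V) : ∑ ξ ∈ s, T d w₁ w₂ x ξ ≤ w₁ x :=
  le_of_tendsto' (tendsto_finsetSum s fun ξ _ => tendsto_application_fill hd hd' h₁ h₂ x ξ)
    fun n => sum_fill_le (hd x) (fun ξ => sub_nonneg.2 (R_le hd hd' h₁ h₂ n x ξ)) (h₁ x) s

lemma sum_T_le_right (ξ : V) (s : Finset V) : ∑ x ∈ s, T d w₁ w₂ x ξ ≤ w₂ ξ :=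
  le_of_tendsto' (tendsto_finsetSum s fun x _ => tendsto_rejection_fill hd hd' h₁ h₂ x ξ)
    fun n => sum_fill_le (hd' ξ) (fun x => A_nonneg hd hd' h₁ h₂ n x ξ) (h₂ ξ) s

omit hd hd' h₁ h₂ in
-- Once a fixed ball can hold all of `w`, each filling lives on that finite ball with total `w`, so
-- no mass escapes to infinity in the limit.
lemma hasSum_of_tendsto_fill {D : V → ℕ} {F : ℕ → V → ℝ} {t : V → ℝ} {w : ℝ} {k : ℕ}
    (hD : ∀ k, {u | D u ≤ k}.Finite) (hF : ∀ n v, 0 ≤ F n v) (hw : 0 ≤ w)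
    (ht : ∀ v, Tendsto (fun n => fill D (F n) w v) atTop (𝓝 (t v)))
    (h : ∀ᶠ n in atTop, w ≤ ∑ᶠ u ∈ {u | D u ≤ k}, F n u) : HasSum t w := by
  have h0 : ∀ v, k < D v → t v = 0 := fun v hv =>
    tendsto_nhds_unique (ht v) ((tendsto_congr' (h.mono fun n hn =>
      (fill_eq_zero_of_ball hD (hF n) hn hv))).2 tendsto_const_nhds)
  have h1 := hasSum_of_ball hD h0
  convert! h1
  rw [finsum_mem_eq_finite_toFinset_sum _ (hD k)]
  refine tendsto_nhds_unique ?_ (tendsto_finsetSum _ fun v _ => ht v)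
  refine (tendsto_congr' (h.mono fun n hn => ?_)).2 tendsto_const_nhds
  rw [← finsum_mem_eq_finite_toFinset_sum _ (hD k), finsum_ball_fill hD (hF n) hw, min_eq_left hn]

/-- If some site is not exhausted, then all centers are sated. -/
theorem hasSum_T_left_or_right :
    (∀ x, HasSum (fun ξ => T d w₁ w₂ x ξ) (w₁ x)) ∨
      ∀ ξ, HasSum (fun x => T d w₁ w₂ x ξ) (w₂ ξ) := by
  by_contra! h
  obtain ⟨⟨x, hx⟩, ξ, hξ⟩ := h
  refine hξ (hasSum_of_tendsto_fill (k := d x ξ) (hd' ξ) (fun n x => A_nonneg hd hd' h₁ h₂ n x ξ)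
    (h₂ ξ) (fun x => tendsto_rejection_fill hd hd' h₁ h₂ x ξ) ?_)
  have hR : ∀ n ξ, 0 ≤ w₂ ξ - R d w₁ w₂ n x ξ := fun n ξ =>
    sub_nonneg.2 (R_le hd hd' h₁ h₂ n x ξ)
  -- Otherwise the ball around `x` reaching to `ξ` could hold `w₁ x` at every stage, and `x` would
  -- be exhausted in the limit.
  obtain ⟨n, hn⟩ : ∃ n, ∑ᶠ u ∈ {u | d x u ≤ d x ξ}, (w₂ u - R d w₁ w₂ n x u) < w₁ x := by
    by_contra! hc
    exact hx (hasSum_of_tendsto_fill (hd x) hR (h₁ x)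
      (fun ξ => tendsto_application_fill hd hd' h₁ h₂ x ξ) (Eventually.of_forall hc))
  have hA : A d w₁ w₂ n x ξ = w₂ ξ := by
    rw [A_eq hd hd' h₁ h₂, fill_eq_self (hd x) (hR n) ξ hn.le, add_sub_cancel]
  -- Applications increase, so from stage `n` on the site `x` alone offers `ξ` its whole capacity,
  -- within radius `d x ξ`.
  filter_upwards [eventually_ge_atTop n] with m hm
  calc w₂ ξ ≤ A d w₁ w₂ m x ξ := hA ▸ A_monotone hd hd' h₁ h₂ x ξ hm
    _ ≤ _ := le_finsum_mem (f := fun x => A d w₁ w₂ m x ξ) (hd' ξ _)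
      (fun x => A_nonneg hd hd' h₁ h₂ m x ξ) (le_refl (d x ξ))

end Algorithm

end StableTransport

/-! ## Neighbourhoods and re-rooting -/

namespace MarkedMultigraph

universe u
variable {Ξ : Type u} {G H : MarkedMultigraph Ξ}

lemma mem_induce_ends {S : Set G.V} {v : (G.induce S).V} {e : (G.induce S).E} :
    v ∈ (G.induce S).ends e ↔ v.1 ∈ G.ends e.1 := by
  have h : ((G.induce S).ends e).map Subtype.val = G.ends e.1 := Sym2.attachWith_map_subtypeVal _
  rw [← h]
  refine Iff.trans ⟨fun h => ⟨v, h, rfl⟩, ?_⟩ Sym2.mem_map.symm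
  rintro ⟨w, hw, hwv⟩
  exact (Subtype.ext hwv : w = v) ▸ hw

lemma induce_adj {S : Set G.V} {v w : G.V} (hv : v ∈ S) (hw : w ∈ S) :
    (G.induce S).graph.Adj ⟨v, hv⟩ ⟨w, hw⟩ ↔ G.graph.Adj v w := by
  constructor
  · rintro ⟨hne, e, he⟩
    refine ⟨fun h => hne (Subtype.ext h), e.1, ?_⟩
    have h : ((G.induce S).ends e).map Subtype.val = G.ends e.1 := Sym2.attachWith_map_subtypeVal _
    rw [← h, he]
    rfl
  · rintro ⟨hne, e, he⟩
    refine ⟨fun h => hne (congrArg Subtype.val h), ⟨e, ?_⟩, ?_⟩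
    · intro x hx
      rw [he, Sym2.mem_iff] at hx
      rcases hx with rfl | rfl <;> assumption
    · refine Sym2.map.injective Subtype.val_injective ?_
      exact (Sym2.attachWith_map_subtypeVal _).trans he

/-- Every end of the image edge is the image of an end of `e`. This makes the edge map of
`GraphIso.restrict` well defined. -/
lemma GraphIso.ends_image_subset {S S' : Set G.V} {T T' : Set H.V}
    (f : GraphIso (G.induce S) (H.induce T)) (hS : S' ⊆ S)
    (h : ∀ v (hv : v ∈ S'), (f.toV ⟨v, hS hv⟩).1 ∈ T') (e : G.E) (he : ∀ v ∈ G.ends e, v ∈ S') :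
    ∀ w ∈ H.ends (f.toE ⟨e, fun v hv => hS (he v hv)⟩).1, w ∈ T' := by
  intro w hw
  have hwT : w ∈ T := (f.toE ⟨e, fun v hv => hS (he v hv)⟩).2 w hw
  obtain ⟨v, hv⟩ := f.toV.surjective ⟨w, hwT⟩
  have hve : v ∈ (G.induce S).ends ⟨e, fun v hv => hS (he v hv)⟩ :=
    (f.mem_ends v _).2 (mem_induce_ends.2 (by rw [hv]; exact hw))
  have hv' := he _ (mem_induce_ends.1 hve)
  have hw' : (f.toV ⟨v.1, hS hv'⟩).1 = w := congrArg Subtype.val hv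
  exact hw' ▸ h v.1 hv'

/-- The restriction of an isomorphism between induced multigraphs to smaller vertex sets. -/
def GraphIso.restrict {S S' : Set G.V} {T T' : Set H.V} (f : GraphIso (G.induce S) (H.induce T))
    (hS : S' ⊆ S) (hT : T' ⊆ T) (h : ∀ v (hv : v ∈ S'), (f.toV ⟨v, hS hv⟩).1 ∈ T')
    (h' : ∀ w (hw : w ∈ T'), (f.toV.symm ⟨w, hT hw⟩).1 ∈ S') :
    GraphIso (G.induce S') (H.induce T') where
  toV :=
    { toFun := fun v => ⟨(f.toV ⟨v.1, hS v.2⟩).1, h v.1 v.2⟩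
      invFun := fun w => ⟨(f.toV.symm ⟨w.1, hT w.2⟩).1, h' w.1 w.2⟩
      left_inv := fun v => by
        have := congrArg Subtype.val (f.toV.symm_apply_apply ⟨v.1, hS v.2⟩)
        exact Subtype.ext this
      right_inv := fun w => by
        have := congrArg Subtype.val (f.toV.apply_symm_apply ⟨w.1, hT w.2⟩)
        exact Subtype.ext this }
  toE :=
    { toFun := fun e => ⟨(f.toE ⟨e.1, fun v hv => hS (e.2 v hv)⟩).1,
        f.ends_image_subset hS h e.1 e.2⟩
      invFun := fun e => ⟨(f.toE.symm ⟨e.1, fun v hv => hT (e.2 v hv)⟩).1,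
        f.symm.ends_image_subset hT h' e.1 e.2⟩
      left_inv := fun e => by
        have := congrArg Subtype.val (f.toE.symm_apply_apply ⟨e.1, fun v hv => hS (e.2 v hv)⟩)
        exact Subtype.ext this
      right_inv := fun e => by
        have := congrArg Subtype.val (f.toE.apply_symm_apply ⟨e.1, fun v hv => hT (e.2 v hv)⟩)
        exact Subtype.ext this }
  mem_ends v e := by
    have h0 := f.mem_ends ⟨v.1, hS v.2⟩ ⟨e.1, fun v hv => hS (e.2 v hv)⟩
    have h1 := h0.trans mem_induce_ends
    constructor
    · intro hv
      have hv' := mem_induce_ends.1 hv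
      exact mem_induce_ends.2 (h1.1 (mem_induce_ends.2 hv'))
    · intro hv
      have hv' := mem_induce_ends.1 hv
      have hv'' := mem_induce_ends.1 (h1.2 hv')
      exact mem_induce_ends.2 hv''

lemma GraphIso.MarksWithin.restrict [MetricSpace Ξ] {S S' : Set G.V} {T T' : Set H.V}
    {f : GraphIso (G.induce S) (H.induce T)} {ε δ : ℝ} (hf : f.MarksWithin ε) (hε : ε ≤ δ)
    (hS : S' ⊆ S) (hT : T' ⊆ T) (h : ∀ v (hv : v ∈ S'), (f.toV ⟨v, hS hv⟩).1 ∈ T')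
    (h' : ∀ w (hw : w ∈ T'), (f.toV.symm ⟨w, hT hw⟩).1 ∈ S') :
    (f.restrict hS hT h h').MarksWithin δ := by
  refine ⟨fun v => (hf.1 ⟨v.1, hS v.2⟩).trans_le hε, fun v e hve => ?_⟩
  refine (hf.2 ⟨v.1, hS v.2⟩ ⟨e.1, fun v hv => hS (e.2 v hv)⟩ ?_).trans_le hε
  have hve' := mem_induce_ends.1 hve
  exact mem_induce_ends.2 hve'

end MarkedMultigraph

namespace RootedNetwork

universe u
variable {Ξ : Type u} {k l : ℕ} {X Y : RootedNetwork Ξ k}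

lemma mem_nbhd_of_dist_le {r j m : ℕ} {a b : X.V} (ha : a ∈ X.nbhd r) (hab : X.graph.dist a b ≤ j)
    (h : r + j ≤ m) : b ∈ X.nbhd m := by
  obtain ⟨i, hi⟩ := ha
  exact ⟨i, (X.connected.dist_triangle (v := a)).trans ((add_le_add hi hab).trans h)⟩

lemma nbhd_mono {r m : ℕ} (h : r ≤ m) : X.nbhd r ⊆ X.nbhd m :=
  fun _ ⟨i, hi⟩ => ⟨i, hi.trans h⟩

/-- Each step of the walk raises the radius `r` by at most one, so the walk stays inside the
`m`-neighbourhood and `f` carries it edge by edge to `Y`. Distances are those of the whole graphs,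
not of the induced ones. -/
lemma dist_image_le_length {m : ℕ}
    (f : MarkedMultigraph.GraphIso (X.induce (X.nbhd m)) (Y.induce (Y.nbhd m))) {a b : X.V}
    (p : X.graph.Walk a b) : ∀ {r : ℕ} (ha : a ∈ X.nbhd r) (h : r + p.length ≤ m)
    (hb : b ∈ X.nbhd m), Y.graph.dist (f.toV ⟨a, nbhd_mono (by omega) ha⟩).1 (f.toV ⟨b, hb⟩).1 ≤
      p.length := by
  induction p with
  | nil => intro r ha h hb; simp
  | @cons a c b hac p ih =>
    intro r ha h hb
    rw [SimpleGraph.Walk.length_cons] at h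
    have hc : c ∈ X.nbhd (r + 1) :=
      mem_nbhd_of_dist_le ha (SimpleGraph.dist_eq_one_iff_adj.2 hac).le le_rfl
    have h1 := ih hc (by omega) hb
    have h2 := (MarkedMultigraph.induce_adj (Subtype.prop _) (Subtype.prop _)).1
      (f.adj ((MarkedMultigraph.induce_adj (nbhd_mono (by omega) ha)
        (nbhd_mono (by omega) hc)).2 hac))
    have h3 := (SimpleGraph.dist_eq_one_iff_adj.2 h2).le
    rw [SimpleGraph.Walk.length_cons, add_comm]
    exact (Y.connected.dist_triangle).trans (add_le_add h3 h1)

lemma dist_image_le {m r j : ℕ}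
    (f : MarkedMultigraph.GraphIso (X.induce (X.nbhd m)) (Y.induce (Y.nbhd m))) {a b : X.V}
    (ha : a ∈ X.nbhd r) (ha' : a ∈ X.nbhd m) (hb : b ∈ X.nbhd m) (hab : X.graph.dist a b ≤ j)
    (h : r + j ≤ m) : Y.graph.dist (f.toV ⟨a, ha'⟩).1 (f.toV ⟨b, hb⟩).1 ≤ j := by
  obtain ⟨p, hp⟩ := X.connected.exists_walk_length_eq_dist a b
  exact (dist_image_le_length f p ha (by omega) hb).trans (by omega)

/-- Closeness is inherited, with a loss in the radius, when other roots are chosen. -/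
lemma near_reroot [MetricSpace Ξ] {m n r : ℕ}
    (f : MarkedMultigraph.GraphIso (X.induce (X.nbhd m)) (Y.induce (Y.nbhd m)))
    (hf : f.MarksWithin (1 / ((m : ℝ) + 1)))
    (hroot : ∀ i, f.toV ⟨X.root i, X.root_mem_nbhd m i⟩ = ⟨Y.root i, Y.root_mem_nbhd m i⟩)
    (h : r + n ≤ m) (ρ : Fin l → X.V) (ρ' : Fin l → Y.V) (hρ : ∀ i, ρ i ∈ X.nbhd r)
    (hρ' : ∀ i, (f.toV ⟨ρ i, nbhd_mono (by omega) (hρ i)⟩).1 = ρ' i) :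
    Near n (⟨X.toNetwork, ρ⟩ : RootedNetwork Ξ l) ⟨Y.toNetwork, ρ'⟩ := by
  -- The same distance estimate for `f` puts the new roots of `Y` equally deep, so that `f.symm` can
  -- be treated like `f` below.
  have hY : ∀ i, ρ' i ∈ Y.nbhd r := fun i => by
    obtain ⟨j, hj⟩ := hρ i
    have := dist_image_le f (X.root_mem_nbhd 0 j) (X.root_mem_nbhd m j)
      (nbhd_mono (by omega) (hρ i)) hj (by omega)
    rw [hroot, hρ'] at this
    exact ⟨j, this⟩
  have hS : (⟨X.toNetwork, ρ⟩ : RootedNetwork Ξ l).nbhd n ⊆ X.nbhd m := by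
    rintro v ⟨i, hi⟩
    exact mem_nbhd_of_dist_le (hρ i) hi h
  have hT : (⟨Y.toNetwork, ρ'⟩ : RootedNetwork Ξ l).nbhd n ⊆ Y.nbhd m := by
    rintro v ⟨i, hi⟩
    exact mem_nbhd_of_dist_le (hY i) hi h
  have h1 : ∀ v (hv : v ∈ (⟨X.toNetwork, ρ⟩ : RootedNetwork Ξ l).nbhd n),
      (f.toV ⟨v, hS hv⟩).1 ∈ (⟨Y.toNetwork, ρ'⟩ : RootedNetwork Ξ l).nbhd n := by
    intro v hv
    obtain ⟨i, hi⟩ := id hv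
    refine ⟨i, ?_⟩
    have := dist_image_le f (hρ i) (nbhd_mono (by omega) (hρ i)) (hS hv) hi h
    rwa [hρ'] at this
  have h2 : ∀ w (hw : w ∈ (⟨Y.toNetwork, ρ'⟩ : RootedNetwork Ξ l).nbhd n),
      (f.toV.symm ⟨w, hT hw⟩).1 ∈ (⟨X.toNetwork, ρ⟩ : RootedNetwork Ξ l).nbhd n := by
    intro w hw
    obtain ⟨i, hi⟩ := id hw
    refine ⟨i, ?_⟩
    have := dist_image_le f.symm (hY i) (nbhd_mono (by omega) (hY i)) (hT hw) hi h
    have e : f.symm.toV ⟨ρ' i, nbhd_mono (by omega) (hY i)⟩ =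
        ⟨ρ i, nbhd_mono (by omega) (hρ i)⟩ := by
      refine (Equiv.symm_apply_eq _).2 (Subtype.ext (hρ' i).symm)
    rwa [e] at this
  refine ⟨f.restrict hS hT h1 h2, hf.restrict ?_ hS hT h1 h2, fun i => Subtype.ext (hρ' i)⟩
  have : (n : ℝ) ≤ m := by exact_mod_cast (by omega : n ≤ m)
  gcongr

end RootedNetwork

/-! ### Measurability of sums over the vertices -/

section Measurability

universe u
variable {Ξ : Type u} {k l : ℕ}

/-- Choosing (and repeating, permuting) some of the roots. -/
def NetworkClass.reroot (σ : Fin l → Fin k) : NetworkClass Ξ k → NetworkClass Ξ l :=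
  Quotient.lift (fun X : RootedNetwork Ξ k =>
    (⟨X.toNetwork, fun i => X.root (σ i)⟩ : RootedNetwork Ξ l).cls) (by
      rintro X Y ⟨f, hf, h⟩
      exact Quotient.sound ⟨f, hf, fun i => h (σ i)⟩)

/-- `[G, o, v] ↦ [G, o]` -/
def GStarStar.fst : GStarStar Ξ → GStar Ξ := NetworkClass.reroot fun _ => 0

/-- `[G, o, v] ↦ [G, v]` -/
def GStarStar.snd : GStarStar Ξ → GStar Ξ := NetworkClass.reroot fun _ => 1

/-- `[G, o, v] ↦ [G, v, o]` -/
def GStarStar.swap : GStarStar Ξ → GStarStar Ξ := NetworkClass.reroot ![1, 0]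

@[simp] lemma GStarStar.fst_cls₂ (G : Network Ξ) (x y : G.V) :
    GStarStar.fst (G.cls₂ x y) = G.cls₁ x := by
  refine congrArg (fun ρ => RootedNetwork.cls (⟨G, ρ⟩ : RootedNetwork Ξ 1)) ?_
  funext i
  fin_cases i
  rfl

@[simp] lemma GStarStar.snd_cls₂ (G : Network Ξ) (x y : G.V) :
    GStarStar.snd (G.cls₂ x y) = G.cls₁ y := by
  refine congrArg (fun ρ => RootedNetwork.cls (⟨G, ρ⟩ : RootedNetwork Ξ 1)) ?_
  funext i
  fin_cases i
  rfl

@[simp] lemma GStarStar.swap_cls₂ (G : Network Ξ) (x y : G.V) :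
    GStarStar.swap (G.cls₂ x y) = G.cls₂ y x := by
  refine congrArg (fun ρ => RootedNetwork.cls (⟨G, ρ⟩ : RootedNetwork Ξ 2)) ?_
  funext i
  fin_cases i <;> rfl

/-- The distance of the two roots. -/
noncomputable def GStarStar.dist : GStarStar Ξ → ℕ :=
  Quotient.lift (fun X : RootedNetwork Ξ 2 => X.graph.dist (X.root 0) (X.root 1)) (by
    rintro X Y ⟨f, hf, h⟩
    rw [← h 0, ← h 1, f.dist_eq X.connected Y.connected])

@[simp] lemma GStarStar.dist_cls₂ (G : Network Ξ) (x y : G.V) :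
    GStarStar.dist (G.cls₂ x y) = G.graph.dist x y := rfl

lemma RootedNetwork.cls_eq_cls₁ (X : RootedNetwork Ξ 1) :
    X.cls = X.toNetwork.cls₁ (X.root 0) := by
  refine congrArg (fun ρ => RootedNetwork.cls (⟨X.toNetwork, ρ⟩ : RootedNetwork Ξ 1)) ?_
  funext i
  fin_cases i
  rfl

lemma RootedNetwork.cls_eq_cls₂ (X : RootedNetwork Ξ 2) :
    X.cls = X.toNetwork.cls₂ (X.root 0) (X.root 1) := by
  refine congrArg (fun ρ => RootedNetwork.cls (⟨X.toNetwork, ρ⟩ : RootedNetwork Ξ 2)) ?_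
  funext i
  fin_cases i <;> rfl

lemma GStar.exists_cls₁ (x : GStar Ξ) : ∃ (G : Network Ξ) (o : G.V), G.cls₁ o = x := by
  obtain ⟨X, rfl⟩ := Quotient.exists_rep x
  exact ⟨X.toNetwork, X.root 0, X.cls_eq_cls₁.symm⟩

lemma GStarStar.exists_cls₂ (p : GStarStar Ξ) :
    ∃ (G : Network Ξ) (x y : G.V), G.cls₂ x y = p := by
  obtain ⟨X, rfl⟩ := Quotient.exists_rep p
  exact ⟨X.toNetwork, X.root 0, X.root 1, X.cls_eq_cls₂.symm⟩

/-- `∑_{v ∈ V(G)} g[G, o, v]` for functions with values in `[0, ∞]`. -/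
noncomputable def outSum (g : GStarStar Ξ → ℝ≥0∞) : GStar Ξ → ℝ≥0∞ :=
  Quotient.lift
    (fun X : RootedNetwork Ξ 1 => ∑' v : X.V, g (X.toNetwork.cls₂ (X.root 0) v)) (by
      rintro X Y ⟨f, hf, h⟩
      rw [← Equiv.tsum_eq f.toV, ← h 0]
      exact tsum_congr fun v => by
        rw [Network.cls₂_map (G := X.toNetwork) (H := Y.toNetwork) f hf])

lemma outSum_cls₁ (g : GStarStar Ξ → ℝ≥0∞) (G : Network Ξ) (o : G.V) :
    outSum g (G.cls₁ o) = ∑' v, g (G.cls₂ o v) := rfl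

lemma massOut_cls₁ (g : GStarStar Ξ → ℝ≥0) (G : Network Ξ) (o : G.V) :
    massOut g (G.cls₁ o) = ∑' v, (g (G.cls₂ o v) : ℝ≥0∞) := rfl

lemma massIn_cls₁ (g : GStarStar Ξ → ℝ≥0) (G : Network Ξ) (o : G.V) :
    massIn g (G.cls₁ o) = ∑' v, (g (G.cls₂ v o) : ℝ≥0∞) := rfl

lemma massIn_eq_massOut_swap (g : GStarStar Ξ → ℝ≥0) :
    massIn g = massOut fun p => g (GStarStar.swap p) := by
  funext x
  obtain ⟨G, o, rfl⟩ := x.exists_cls₁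
  simp only [massIn_cls₁, massOut_cls₁, GStarStar.swap_cls₂]

lemma Network.finite_setOf_adj (G : Network Ξ) (v : G.V) : {w | G.graph.Adj v w}.Finite := by
  have h : (⋃ e ∈ {e | v ∈ G.ends e}, {w | w ∈ G.ends e}).Finite := by
    refine (G.locallyFinite v).biUnion fun e _ => ?_
    obtain ⟨a, b, hab⟩ : ∃ a b, G.ends e = s(a, b) := by
      induction h : G.ends e with | _ a b => exact ⟨a, b, rfl⟩
    refine (Set.toFinite {a, b}).subset fun w hw => ?_
    have hw' : w ∈ G.ends e := hw
    rw [hab, Sym2.mem_iff] at hw'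
    simpa using hw'
  refine h.subset ?_
  rintro w ⟨-, e, he⟩
  simp only [mem_iUnion]
  refine ⟨e, ?_, ?_⟩
  · change v ∈ G.ends e
    rw [he]; exact Sym2.mem_mk_left _ _
  · change w ∈ G.ends e
    rw [he]; exact Sym2.mem_mk_right _ _

lemma Network.finite_ball (G : Network Ξ) (o : G.V) (r : ℕ) :
    {v | G.graph.dist o v ≤ r}.Finite := by
  induction r with
  | zero =>
    refine (Set.finite_singleton o).subset fun v (hv : G.graph.dist o v ≤ 0) => ?_
    exact (G.connected.dist_eq_zero_iff.1 (Nat.le_zero.1 hv)).symm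
  | succ r ih =>
    refine (ih.union (ih.biUnion fun v _ => G.finite_setOf_adj v)).subset fun v hv => ?_
    have hv' : G.graph.dist o v ≤ r + 1 := hv
    rcases hv'.eq_or_lt with h | h
    -- The walk runs from `v` to `o`, so its second vertex `w` lies in the ball of radius `r` and is
    -- adjacent to `v`.
    · obtain ⟨p, hp⟩ := G.connected.exists_walk_length_eq_dist v o
      rw [SimpleGraph.dist_comm, h] at hp
      cases p with
      | nil => simp at hp
      | @cons _ w _ hvw p =>
        refine Or.inr (mem_iUnion₂.2 ⟨w, ?_, hvw.symm⟩)
        have h2 := SimpleGraph.dist_le p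
        rw [SimpleGraph.Walk.length_cons] at hp
        change G.graph.dist o w ≤ r
        rw [SimpleGraph.dist_comm]
        omega
    · exact Or.inl (Nat.lt_succ_iff.1 h)

lemma Network.finite_ball' (G : Network Ξ) (o : G.V) (r : ℕ) :
    {v | G.graph.dist v o ≤ r}.Finite := by
  simpa only [SimpleGraph.dist_comm] using G.finite_ball o r

variable [MetricSpace Ξ]

lemma NetworkClass.continuous_reroot (σ : Fin l → Fin k) :
    Continuous (NetworkClass.reroot σ : NetworkClass Ξ k → NetworkClass Ξ l) := by
  refine ⟨fun U hU X hX => ?_⟩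
  obtain ⟨n, hn⟩ := hU ⟨X.toNetwork, fun i => X.root (σ i)⟩ hX
  refine ⟨n, fun m hm Y ⟨f, hf, hroot⟩ => hn n le_rfl _ ?_⟩
  exact RootedNetwork.near_reroot f hf hroot (r := 0) (by omega) _ _
    (fun i => X.root_mem_nbhd 0 (σ i)) fun i => congrArg Subtype.val (hroot (σ i))

lemma GStarStar.measurable_fst : Measurable (GStarStar.fst : GStarStar Ξ → GStar Ξ) :=
  (NetworkClass.continuous_reroot _).measurable

lemma GStarStar.measurable_snd : Measurable (GStarStar.snd : GStarStar Ξ → GStar Ξ) :=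
  (NetworkClass.continuous_reroot _).measurable

lemma GStarStar.measurable_swap : Measurable (GStarStar.swap : GStarStar Ξ → GStarStar Ξ) :=
  (NetworkClass.continuous_reroot _).measurable

/-- A walk of length at most `n` between the roots lies in a neighbourhood that all nearby networks
share. -/
lemma GStarStar.isOpen_dist_le (n : ℕ) : IsOpen {p : GStarStar Ξ | GStarStar.dist p ≤ n} := by
  intro X hX
  have hX' : X.graph.dist (X.root 0) (X.root 1) ≤ n := hX
  refine ⟨n, fun m hm Y ⟨f, hf, hroot⟩ => ?_⟩
  have := RootedNetwork.dist_image_le f (X.root_mem_nbhd 0 0) (X.root_mem_nbhd m 0)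
    (X.root_mem_nbhd m 1) hX' (by omega)
  rw [hroot, hroot] at this
  exact this

lemma GStarStar.measurable_dist : Measurable (GStarStar.dist : GStarStar Ξ → ℕ) :=
  measurable_of_Iic fun n => (GStarStar.isOpen_dist_le n).measurableSet

/-- Lower semicontinuity of a count: finitely many vertices `v` with `[G, o, v] ∈ U` already exceed
`c`, and a local isomorphism of large radius carries them to distinct vertices with the same
property. -/
lemma isOpen_lt_outSum_indicator {U : Set (GStarStar Ξ)} (hU : IsOpen U) (c : ℝ≥0∞) :
    IsOpen {x : GStar Ξ | c < outSum (U.indicator 1) x} := by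
  classical
  intro X hX
  rw [X.cls_eq_cls₁, mem_ofPred_eq, outSum_cls₁, ENNReal.tsum_eq_iSup_sum, lt_iSup_iff] at hX
  obtain ⟨s, hs⟩ := hX
  have hN : ∀ v : X.V, ∃ n, X.toNetwork.cls₂ (X.root 0) v ∈ U →
      ∀ m ≥ n, ∀ Y : RootedNetwork Ξ 2,
        (⟨X.toNetwork, ![X.root 0, v]⟩ : RootedNetwork Ξ 2).Near m Y → Y.cls ∈ U := by
    intro v
    by_cases hv : X.toNetwork.cls₂ (X.root 0) v ∈ U
    · obtain ⟨n, hn⟩ := hU ⟨X.toNetwork, ![X.root 0, v]⟩ hv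
      exact ⟨n, fun _ => hn⟩
    · exact ⟨0, fun h => absurd h hv⟩
  choose N hN using hN
  set r := s.sup fun v => X.graph.dist (X.root 0) v
  have hsr : ∀ v ∈ s, v ∈ X.nbhd r := fun v hv =>
    ⟨0, Finset.le_sup (f := fun v => X.graph.dist (X.root 0) v) hv⟩
  have hsN : ∀ v ∈ s, N v ≤ s.sup N := fun v hv => Finset.le_sup hv
  -- Radius `r` reaches the vertices of `s`; the further `s.sup N` leaves enough room around them to
  -- certify membership in `U` after re-rooting.
  refine ⟨r + s.sup N, fun m hm Y ⟨f, hf, hroot⟩ => ?_⟩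
  rw [mem_ofPred_eq, Y.cls_eq_cls₁, outSum_cls₁]
  let φ : s → Y.V := fun v => (f.toV ⟨v.1, RootedNetwork.nbhd_mono (by omega) (hsr v.1 v.2)⟩).1
  have hφ : Function.Injective φ := by
    intro v w h
    have := f.toV.injective (Subtype.ext h)
    have := congrArg Subtype.val this
    exact Subtype.ext this
  calc c < ∑ v ∈ s, U.indicator 1 (X.toNetwork.cls₂ (X.root 0) v) := hs
    _ = ∑' v : s, U.indicator 1 (X.toNetwork.cls₂ (X.root 0) v) := by
      exact (Finset.tsum_subtype s fun v => U.indicator 1 (X.toNetwork.cls₂ (X.root 0) v)).symm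
    _ ≤ ∑' v : s, U.indicator 1 (Y.toNetwork.cls₂ (Y.root 0) (φ v)) := by
      refine ENNReal.tsum_le_tsum fun v => ?_
      by_cases hv : X.toNetwork.cls₂ (X.root 0) v ∈ U
      · have : Y.toNetwork.cls₂ (Y.root 0) (φ v) ∈ U := by
          refine hN v hv (N v) le_rfl ⟨Y.toNetwork, ![Y.root 0, φ v]⟩ ?_
          refine RootedNetwork.near_reroot f hf hroot (r := r) ?_ _ _ ?_ ?_
          · have := hsN v.1 v.2
            omega
          · intro i
            fin_cases i
            · exact X.root_mem_nbhd r 0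
            · exact hsr v.1 v.2
          · intro i
            fin_cases i
            · exact congrArg Subtype.val (hroot 0)
            · rfl
        simp [hv, this]
      · simp [hv]
    _ ≤ ∑' v, U.indicator 1 (Y.toNetwork.cls₂ (Y.root 0) v) :=
      ENNReal.tsum_comp_le_tsum_of_injective hφ _

/-- The sum of the point masses at `[G, o, v]`, where `v` is within distance `r` of `o`. -/
noncomputable def ballMeasure (r : ℕ) (x : GStar Ξ) : Measure (GStarStar Ξ) :=
  (Measure.sum fun v : (Quotient.out x).V =>
    Measure.dirac ((Quotient.out x).toNetwork.cls₂ ((Quotient.out x).root 0) v)).restrict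
      {p | GStarStar.dist p ≤ r}

lemma measurableSet_dist_le (r : ℕ) : MeasurableSet {p : GStarStar Ξ | GStarStar.dist p ≤ r} :=
  (GStarStar.isOpen_dist_le r).measurableSet

lemma lintegral_ballMeasure (r : ℕ) (x : GStar Ξ) {g : GStarStar Ξ → ℝ≥0∞} (hg : Measurable g) :
    ∫⁻ p, g p ∂(ballMeasure r x) = outSum ({p | GStarStar.dist p ≤ r}.indicator g) x := by
  have hx : x = (Quotient.out x).toNetwork.cls₁ ((Quotient.out x).root 0) := by
    rw [← RootedNetwork.cls_eq_cls₁]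
    exact (Quotient.out_eq x).symm
  conv_rhs => rw [hx, outSum_cls₁]
  rw [ballMeasure, ← lintegral_indicator (measurableSet_dist_le r), lintegral_sum_measure]
  exact tsum_congr fun v => lintegral_dirac' _ (hg.indicator (measurableSet_dist_le r))

lemma ballMeasure_apply (r : ℕ) (x : GStar Ξ) {s : Set (GStarStar Ξ)} (hs : MeasurableSet s) :
    ballMeasure r x s = outSum (({p | GStarStar.dist p ≤ r} ∩ s).indicator 1) x := by
  rw [← lintegral_indicator_one hs, lintegral_ballMeasure r x (measurable_one.indicator hs),
    indicator_indicator]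

instance (r : ℕ) (x : GStar Ξ) : IsFiniteMeasure (ballMeasure r x) := by
  refine ⟨?_⟩
  obtain ⟨G, o, rfl⟩ := x.exists_cls₁
  rw [ballMeasure_apply r _ MeasurableSet.univ, outSum_cls₁, inter_univ,
    tsum_eq_sum (s := (G.finite_ball o r).toFinset)]
  · refine ENNReal.sum_lt_top.2 fun v _ => lt_of_le_of_lt ?_ ENNReal.one_lt_top
    exact indicator_le_self' (fun _ _ => zero_le_one) _
  · intro v hv
    refine indicator_of_notMem ?_ _
    simpa using hv

/-- Open sets form a π-system generating the Borel sets, and on them the count is lower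
semicontinuous. The extension to all Borel sets needs finite measures, which is why the sum is
truncated at distance `r`. -/
lemma measurable_ballMeasure (r : ℕ) :
    Measurable (ballMeasure r : GStar Ξ → Measure (GStarStar Ξ)) := by
  have key : ∀ U : Set (GStarStar Ξ), IsOpen U → Measurable fun x => ballMeasure r x U := by
    intro U hU
    simp only [ballMeasure_apply r _ hU.measurableSet]
    exact measurable_of_Ioi fun c =>
      (isOpen_lt_outSum_indicator ((GStarStar.isOpen_dist_le r).inter hU) c).measurableSet
  exact Measurable.measure_of_isPiSystem (BorelSpace.measurable_eq (α := GStarStar Ξ))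
    isPiSystem_isOpen key (key univ isOpen_univ)

lemma measurable_outSum {g : GStarStar Ξ → ℝ≥0∞} (hg : Measurable g) : Measurable (outSum g) := by
  have h : outSum g = fun x => ⨆ r : ℕ, ∫⁻ p, g p ∂(ballMeasure r x) := by
    funext x
    obtain ⟨G, o, rfl⟩ := x.exists_cls₁
    simp only [lintegral_ballMeasure _ _ hg, outSum_cls₁]
    refine le_antisymm ?_ (iSup_le fun r => ENNReal.tsum_le_tsum fun v =>
      indicator_le_self _ _ _)
    rw [ENNReal.tsum_eq_iSup_sum]
    refine iSup_le fun s => le_iSup_of_le (s.sup fun v => G.graph.dist o v) ?_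
    refine le_trans (Finset.sum_le_sum fun v hv => ?_) (ENNReal.sum_le_tsum s)
    rw [indicator_of_mem]
    exact Finset.le_sup (f := fun v => G.graph.dist o v) hv
  rw [h]
  exact Measurable.iSup fun r => (Measure.measurable_lintegral hg).comp (measurable_ballMeasure r)

lemma measurable_massOut {g : GStarStar Ξ → ℝ≥0} (hg : Measurable g) : Measurable (massOut g) :=
  measurable_outSum hg.coe_nnreal_ennreal

lemma measurable_massIn {g : GStarStar Ξ → ℝ≥0} (hg : Measurable g) : Measurable (massIn g) := by
  rw [massIn_eq_massOut_swap]
  exact measurable_massOut (hg.comp GStarStar.measurable_swap)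

end Measurability

/-! ## Measurability of the transport kernel -/

section KernelMeasurability

universe u
variable {Ξ : Type u}

lemma toReal_outSum_indicator (F : GStarStar Ξ → ℝ) (hF : ∀ p, 0 ≤ F p) (S : Set (GStarStar Ξ))
    (G : Network Ξ) (x : G.V) (hS : {u | G.cls₂ x u ∈ S}.Finite) :
    (outSum (S.indicator fun p => ENNReal.ofReal (F p)) (G.cls₁ x)).toReal =
      ∑ᶠ u ∈ {u | G.cls₂ x u ∈ S}, F (G.cls₂ x u) := by
  rw [outSum_cls₁, tsum_eq_sum (s := hS.toFinset), ENNReal.toReal_sum,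
    finsum_mem_eq_finite_toFinset_sum _ hS]
  · refine Finset.sum_congr rfl fun u hu => ?_
    have hu' : G.cls₂ x u ∈ S := by simpa using hu
    rw [indicator_of_mem hu', ENNReal.toReal_ofReal (hF _)]
  · intro u hu
    have hu' : G.cls₂ x u ∈ S := by simpa using hu
    rw [indicator_of_mem hu']
    exact ENNReal.ofReal_ne_top
  · intro u hu
    exact indicator_of_notMem (by simpa using hu) _

/-- The rejections `R_n(x, ξ)` as a function of `[G, x, ξ]`. -/
noncomputable def rejectionKernel (w₁ w₂ : GStar Ξ → ℝ≥0) (n : ℕ) : GStarStar Ξ → ℝ :=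
  Quotient.lift (fun X : RootedNetwork Ξ 2 =>
    StableTransport.R X.graph.dist (fun v => (w₁ (X.toNetwork.cls₁ v) : ℝ))
      (fun v => (w₂ (X.toNetwork.cls₁ v) : ℝ)) n (X.root 0) (X.root 1)) (by
    rintro X Y ⟨f, hf, h⟩
    rw [← h 0, ← h 1]
    exact (StableTransport.R_map f.toV (f.dist_eq X.connected Y.connected)
      (fun v => by rw [Network.cls₁_map (G := X.toNetwork) (H := Y.toNetwork) f hf])
      (fun v => by rw [Network.cls₁_map (G := X.toNetwork) (H := Y.toNetwork) f hf]) n _ _).symm)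

/-- The applications `A_n(x, ξ)` as a function of `[G, x, ξ]`. -/
noncomputable def applicationKernel (w₁ w₂ : GStar Ξ → ℝ≥0) (n : ℕ) : GStarStar Ξ → ℝ :=
  Quotient.lift (fun X : RootedNetwork Ξ 2 =>
    StableTransport.A X.graph.dist (fun v => (w₁ (X.toNetwork.cls₁ v) : ℝ))
      (fun v => (w₂ (X.toNetwork.cls₁ v) : ℝ)) n (X.root 0) (X.root 1)) (by
    rintro X Y ⟨f, hf, h⟩
    rw [← h 0, ← h 1]
    exact (StableTransport.application_map f.toV (f.dist_eq X.connected Y.connected)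
      (fun v => by rw [Network.cls₁_map (G := X.toNetwork) (H := Y.toNetwork) f hf])
      (fun v => by rw [Network.cls₁_map (G := X.toNetwork) (H := Y.toNetwork) f hf])
      (StableTransport.R_map f.toV (f.dist_eq X.connected Y.connected)
        (fun v => by rw [Network.cls₁_map (G := X.toNetwork) (H := Y.toNetwork) f hf])
        (fun v => by rw [Network.cls₁_map (G := X.toNetwork) (H := Y.toNetwork) f hf]) n) _ _).symm)

lemma rejectionKernel_cls₂ (w₁ w₂ : GStar Ξ → ℝ≥0) (n : ℕ) (G : Network Ξ) (x ξ : G.V) :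
    rejectionKernel w₁ w₂ n (G.cls₂ x ξ) = StableTransport.R G.graph.dist
      (fun v => (w₁ (G.cls₁ v) : ℝ)) (fun v => (w₂ (G.cls₁ v) : ℝ)) n x ξ := rfl

lemma applicationKernel_cls₂ (w₁ w₂ : GStar Ξ → ℝ≥0) (n : ℕ) (G : Network Ξ) (x ξ : G.V) :
    applicationKernel w₁ w₂ n (G.cls₂ x ξ) = StableTransport.A G.graph.dist
      (fun v => (w₁ (G.cls₁ v) : ℝ)) (fun v => (w₂ (G.cls₁ v) : ℝ)) n x ξ := rfl

lemma stableKernel_cls₂ (w₁ w₂ : GStar Ξ → ℝ≥0) (G : Network Ξ) (x ξ : G.V) :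
    stableKernel w₁ w₂ (G.cls₂ x ξ) = StableTransport.T G.graph.dist
      (fun v => (w₁ (G.cls₁ v) : ℝ)) (fun v => (w₂ (G.cls₁ v) : ℝ)) x ξ := rfl

lemma stableKernel_nonneg (w₁ w₂ : GStar Ξ → ℝ≥0) (p : GStarStar Ξ) :
    0 ≤ stableKernel w₁ w₂ p := by
  obtain ⟨G, x, ξ, rfl⟩ := p.exists_cls₂
  exact StableTransport.T_nonneg G.finite_ball G.finite_ball'
    (fun _ => NNReal.coe_nonneg _) (fun _ => NNReal.coe_nonneg _) x ξ

variable [MetricSpace Ξ]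

/-- The fill ratio depends on `[G, x, ξ]` only through `[G, x]` and the integer `d(x, ξ)`. For each
fixed radius the sums over the sphere and the open ball are measurable in `[G, x]`, and there are
countably many radii. -/
lemma measurable_of_eq_fill {F H : GStarStar Ξ → ℝ} {w : GStar Ξ → ℝ} (hF : Measurable F)
    (hF0 : ∀ p, 0 ≤ F p) (hw : Measurable w)
    (hH : ∀ (G : Network Ξ) (x ξ : G.V), H (G.cls₂ x ξ) =
      StableTransport.fill (G.graph.dist x) (fun u => F (G.cls₂ x u)) (w (G.cls₁ x)) ξ) :
    Measurable H := by
  let P : (ℕ → Set ℕ) → ℕ × GStar Ξ → ℝ := fun S q =>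
    (outSum ((GStarStar.dist ⁻¹' S q.1).indicator fun p => ENNReal.ofReal (F p)) q.2).toReal
  have hP : ∀ S, Measurable fun p => P S (GStarStar.dist p, GStarStar.fst p) := by
    intro S
    have : Measurable (P S) := measurable_from_prod_countable_right fun k =>
      (measurable_outSum ((hF.ennreal_ofReal).indicator
        (GStarStar.measurable_dist (MeasurableSet.of_discrete (s := S k))))).ennreal_toReal
    exact this.comp (GStarStar.measurable_dist.prodMk GStarStar.measurable_fst)
  have hHP : H = fun p => F p * min 1 (max 0 (w (GStarStar.fst p) -
      P (fun k => Iio k) (GStarStar.dist p, GStarStar.fst p)) /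
        P (fun k => {k}) (GStarStar.dist p, GStarStar.fst p)) := by
    funext p
    obtain ⟨G, x, ξ, rfl⟩ := p.exists_cls₂
    have h1 := toReal_outSum_indicator F hF0 (GStarStar.dist ⁻¹' Iio (G.graph.dist x ξ)) G x
      (StableTransport.finite_lt (G.finite_ball x) _)
    have h2 := toReal_outSum_indicator F hF0 (GStarStar.dist ⁻¹' {G.graph.dist x ξ}) G x
      (StableTransport.finite_eq (G.finite_ball x) _)
    rw [hH]
    simp only [P, GStarStar.dist_cls₂, GStarStar.fst_cls₂, h1, h2]
    rfl
  rw [hHP]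
  exact hF.mul (measurable_const.min ((measurable_const.max
    ((hw.comp GStarStar.measurable_fst).sub (hP _))).div (hP _)))

variable {w₁ w₂ : GStar Ξ → ℝ≥0}

lemma measurable_applicationKernel_of_rejectionKernel (hw₁ : Measurable w₁) (hw₂ : Measurable w₂)
    {n : ℕ} (h : Measurable (rejectionKernel w₁ w₂ n)) :
    Measurable (applicationKernel w₁ w₂ n) := by
  have key : Measurable fun p => applicationKernel w₁ w₂ n p - rejectionKernel w₁ w₂ n p := by
    refine measurable_of_eq_fill (F := fun p => w₂ (GStarStar.snd p) - rejectionKernel w₁ w₂ n p)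
      (w := fun x => w₁ x) ?_ ?_ hw₁.coe_nnreal_real ?_
    · exact (hw₂.comp GStarStar.measurable_snd).coe_nnreal_real.sub h
    · intro p
      obtain ⟨G, x, ξ, rfl⟩ := p.exists_cls₂
      rw [GStarStar.snd_cls₂]
      exact sub_nonneg.2 (StableTransport.R_le G.finite_ball G.finite_ball'
        (fun _ => NNReal.coe_nonneg _) (fun _ => NNReal.coe_nonneg _) n x ξ)
    · intro G x ξ
      rw [applicationKernel_cls₂, StableTransport.A_eq G.finite_ball G.finite_ball'
        (fun _ => NNReal.coe_nonneg _) (fun _ => NNReal.coe_nonneg _) n x ξ, rejectionKernel_cls₂,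
        add_sub_cancel_left]
      simp only [GStarStar.snd_cls₂, rejectionKernel_cls₂]
  convert! key.add h using 1
  funext p
  simp

/-- The center's filling is organised around the second root, so the roots are swapped to make it
the first. -/
lemma measurable_rejectionKernel_succ (hw₂ : Measurable w₂) {n : ℕ}
    (h : Measurable (applicationKernel w₁ w₂ n)) :
    Measurable (rejectionKernel w₁ w₂ (n + 1)) := by
  have key : Measurable fun p => applicationKernel w₁ w₂ n (GStarStar.swap p) -
      rejectionKernel w₁ w₂ (n + 1) (GStarStar.swap p) := by
    refine measurable_of_eq_fill (F := fun p => applicationKernel w₁ w₂ n (GStarStar.swap p))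
      (w := fun x => w₂ x) (h.comp GStarStar.measurable_swap) ?_ hw₂.coe_nnreal_real ?_
    · intro p
      obtain ⟨G, x, ξ, rfl⟩ := p.exists_cls₂
      rw [GStarStar.swap_cls₂]
      exact StableTransport.A_nonneg G.finite_ball G.finite_ball'
        (fun _ => NNReal.coe_nonneg _) (fun _ => NNReal.coe_nonneg _) n ξ x
    · intro G ξ x
      rw [GStarStar.swap_cls₂, rejectionKernel_cls₂,
        StableTransport.R_succ_eq G.finite_ball G.finite_ball'
        (fun _ => NNReal.coe_nonneg _) (fun _ => NNReal.coe_nonneg _) n x ξ,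
        applicationKernel_cls₂, sub_sub_cancel]
      simp only [GStarStar.swap_cls₂, applicationKernel_cls₂]
      congr 1
      funext u
      exact SimpleGraph.dist_comm
  have e : ∀ p : GStarStar Ξ, GStarStar.swap (GStarStar.swap p) = p := by
    intro p
    obtain ⟨G, x, ξ, rfl⟩ := p.exists_cls₂
    simp
  convert! h.sub (key.comp GStarStar.measurable_swap) using 1
  funext p
  simp [e]

lemma measurable_rejectionKernel (hw₁ : Measurable w₁) (hw₂ : Measurable w₂) (n : ℕ) :
    Measurable (rejectionKernel w₁ w₂ n) := by
  induction n with
  | zero =>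
    have : rejectionKernel w₁ w₂ 0 = fun _ => 0 := by
      funext p
      obtain ⟨G, x, ξ, rfl⟩ := p.exists_cls₂
      rfl
    rw [this]
    exact measurable_const
  | succ n ih =>
    exact measurable_rejectionKernel_succ hw₂
      (measurable_applicationKernel_of_rejectionKernel hw₁ hw₂ ih)

theorem measurable_stableKernel (hw₁ : Measurable w₁) (hw₂ : Measurable w₂) :
    Measurable (stableKernel w₁ w₂) := by
  have hR := measurable_rejectionKernel hw₁ hw₂
  refine measurable_of_tendsto_metrizable (fun n =>
    (measurable_applicationKernel_of_rejectionKernel hw₁ hw₂ (hR n)).sub (hR n)) ?_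
  refine tendsto_pi_nhds.2 fun p => ?_
  obtain ⟨G, x, ξ, rfl⟩ := p.exists_cls₂
  exact StableTransport.tendsto_T G.finite_ball G.finite_ball'
    (fun _ => NNReal.coe_nonneg _) (fun _ => NNReal.coe_nonneg _) x ξ

end KernelMeasurability

/-! ## Balance by mass transport -/

section Balance

universe u
variable {Ξ : Type u}

lemma hasSum_coe_iff_tsum_eq {V : Type} {t : V → ℝ≥0} {w : ℝ≥0} :
    HasSum (fun v => (t v : ℝ)) (w : ℝ) ↔ ∑' v, (t v : ℝ≥0∞) = w := by
  rw [NNReal.hasSum_coe, ← ENNReal.hasSum_coe]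
  exact ENNReal.summable.hasSum_iff

/-- The transport kernel with values in `[0, ∞)`. -/
noncomputable def stableKernelNN (w₁ w₂ : GStar Ξ → ℝ≥0) (p : GStarStar Ξ) : ℝ≥0 :=
  (stableKernel w₁ w₂ p).toNNReal

lemma coe_stableKernelNN (w₁ w₂ : GStar Ξ → ℝ≥0) (p : GStarStar Ξ) :
    (stableKernelNN w₁ w₂ p : ℝ) = stableKernel w₁ w₂ p :=
  Real.coe_toNNReal _ (stableKernel_nonneg w₁ w₂ p)

lemma massOut_stableKernelNN_eq_iff (w₁ w₂ : GStar Ξ → ℝ≥0) (G : Network Ξ) (v : G.V) (w : ℝ≥0) :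
    massOut (stableKernelNN w₁ w₂) (G.cls₁ v) = w ↔
      HasSum (fun ξ => stableKernel w₁ w₂ (G.cls₂ v ξ)) (w : ℝ) := by
  rw [massOut_cls₁, ← hasSum_coe_iff_tsum_eq]
  simp only [coe_stableKernelNN]

lemma massIn_stableKernelNN_eq_iff (w₁ w₂ : GStar Ξ → ℝ≥0) (G : Network Ξ) (v : G.V) (w : ℝ≥0) :
    massIn (stableKernelNN w₁ w₂) (G.cls₁ v) = w ↔
      HasSum (fun ξ => stableKernel w₁ w₂ (G.cls₂ ξ v)) (w : ℝ) := by
  rw [massIn_cls₁, ← hasSum_coe_iff_tsum_eq]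
  simp only [coe_stableKernelNN]

lemma massOut_stableKernelNN_le (w₁ w₂ : GStar Ξ → ℝ≥0) (x : GStar Ξ) :
    massOut (stableKernelNN w₁ w₂) x ≤ w₁ x := by
  obtain ⟨G, o, rfl⟩ := x.exists_cls₁
  rw [massOut_cls₁, ENNReal.tsum_eq_iSup_sum]
  refine iSup_le fun s => ?_
  rw [← ENNReal.ofNNReal_finsetSum, ENNReal.coe_le_coe, ← NNReal.coe_le_coe, NNReal.coe_sum]
  simp only [coe_stableKernelNN, stableKernel_cls₂]
  exact StableTransport.sum_T_le_left G.finite_ball G.finite_ball'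
    (fun _ => NNReal.coe_nonneg _) (fun _ => NNReal.coe_nonneg _) o s

lemma massIn_stableKernelNN_le (w₁ w₂ : GStar Ξ → ℝ≥0) (x : GStar Ξ) :
    massIn (stableKernelNN w₁ w₂) x ≤ w₂ x := by
  obtain ⟨G, o, rfl⟩ := x.exists_cls₁
  rw [massIn_cls₁, ENNReal.tsum_eq_iSup_sum]
  refine iSup_le fun s => ?_
  rw [← ENNReal.ofNNReal_finsetSum, ENNReal.coe_le_coe, ← NNReal.coe_le_coe, NNReal.coe_sum]
  simp only [coe_stableKernelNN, stableKernel_cls₂]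
  exact StableTransport.sum_T_le_right G.finite_ball G.finite_ball'
    (fun _ => NNReal.coe_nonneg _) (fun _ => NNReal.coe_nonneg _) o s

lemma massOut_or_massIn_stableKernelNN_eq (w₁ w₂ : GStar Ξ → ℝ≥0) (G : Network Ξ) :
    (∀ v : G.V, massOut (stableKernelNN w₁ w₂) (G.cls₁ v) = w₁ (G.cls₁ v)) ∨
      ∀ v : G.V, massIn (stableKernelNN w₁ w₂) (G.cls₁ v) = w₂ (G.cls₁ v) := by
  simp only [massOut_stableKernelNN_eq_iff, massIn_stableKernelNN_eq_iff, stableKernel_cls₂]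
  exact StableTransport.hasSum_T_left_or_right G.finite_ball G.finite_ball'
    (fun _ => NNReal.coe_nonneg _) (fun _ => NNReal.coe_nonneg _)

variable [MetricSpace Ξ] {μ : Measure (GStar Ξ)}

lemma invariantSigmaField_le : invariantSigmaField Ξ ≤ NetworkClass.instMeasurableSpace :=
  fun _ h => h.1

/-- The set of networks all of whose vertices have a property is invariant. -/
lemma measurableSet_forall_vertex {s : Set (GStar Ξ)} (hs : MeasurableSet s) :
    MeasurableSet[invariantSigmaField Ξ]
      {x | ∀ (G : Network Ξ) (o : G.V), G.cls₁ o = x → ∀ v : G.V, G.cls₁ v ∈ s} := by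
  have key : ∀ (H : Network Ξ) (o : H.V),
      outSum ((GStarStar.snd ⁻¹' sᶜ).indicator 1) (H.cls₁ o) = 0 ↔ ∀ v, H.cls₁ v ∈ s := by
    intro H o
    rw [outSum_cls₁, ENNReal.tsum_eq_zero]
    refine forall_congr' fun v => ?_
    simp [indicator_apply_eq_zero]
  -- The event says that the number of vertices `v` with `[G, v] ∉ s` is zero, and this number is an
  -- `outSum`.
  have heq : {x | ∀ (G : Network Ξ) (o : G.V), G.cls₁ o = x → ∀ v : G.V, G.cls₁ v ∈ s} =
      outSum ((GStarStar.snd ⁻¹' sᶜ).indicator 1) ⁻¹' {0} := by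
    ext x
    constructor
    · intro h
      obtain ⟨H, o, rfl⟩ := x.exists_cls₁
      exact (key H o).2 (h H o rfl)
    · rintro h G o rfl
      exact (key G o).1 h
  rw [heq]
  refine ⟨measurable_outSum (measurable_one.indicator (GStarStar.measurable_snd hs.compl))
    (measurableSet_singleton 0), fun G o v h => ?_⟩
  exact (key G v).2 ((key G o).1 h)

/-- Everything that happens almost surely at the root happens at all vertices. -/
lemma IsUnimodular.ae_forall_vertex (hμ : IsUnimodular μ) {s : Set (GStar Ξ)}
    (hs : MeasurableSet s) (h : ∀ᵐ x ∂μ, x ∈ s) :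
    ∀ᵐ x ∂μ, ∀ (G : Network Ξ) (o : G.V), G.cls₁ o = x → ∀ v : G.V, G.cls₁ v ∈ s := by
  -- Every vertex sends unit mass to each vertex outside `s`. The root almost surely receives none,
  -- so on average, hence almost surely, it sends none.
  have hg : Measurable ((GStarStar.snd ⁻¹' sᶜ).indicator (1 : GStarStar Ξ → ℝ≥0)) :=
    measurable_one.indicator (GStarStar.measurable_snd hs.compl)
  have h0 : ∫⁻ x, massIn ((GStarStar.snd ⁻¹' sᶜ).indicator 1) x ∂μ = 0 := by
    rw [lintegral_eq_zero_iff (measurable_massIn hg)]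
    filter_upwards [h] with x hx
    obtain ⟨G, o, rfl⟩ := x.exists_cls₁
    rw [massIn_cls₁]
    simp [hx]
  rw [← hμ _ hg, lintegral_eq_zero_iff (measurable_massOut hg)] at h0
  filter_upwards [h0]
  rintro _ hx G o rfl v
  rw [massOut_cls₁, Pi.zero_apply, ENNReal.tsum_eq_zero] at hx
  simpa [indicator_apply] using hx v

/-- The mass transport principle on an invariant event. -/
lemma IsUnimodular.setLIntegral_massOut (hμ : IsUnimodular μ) {B : Set (GStar Ξ)}
    (hB : MeasurableSet[invariantSigmaField Ξ] B) {g : GStarStar Ξ → ℝ≥0} (hg : Measurable g) :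
    ∫⁻ x in B, massOut g x ∂μ = ∫⁻ x in B, massIn g x ∂μ := by
  -- Only senders in `B` are retained; by invariance of `B` this restricts the incoming mass to the
  -- same event as the outgoing mass.
  have hm : Measurable ((GStarStar.fst ⁻¹' B).indicator g) :=
    hg.indicator (GStarStar.measurable_fst hB.1)
  have h := hμ _ hm
  rw [← lintegral_indicator hB.1, ← lintegral_indicator hB.1]
  convert! h using 2
  · funext x
    obtain ⟨G, o, rfl⟩ := x.exists_cls₁
    by_cases ho : G.cls₁ o ∈ B
    · simp [massOut_cls₁, ho]
    · simp [massOut_cls₁, ho]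
  · funext x
    obtain ⟨G, o, rfl⟩ := x.exists_cls₁
    by_cases ho : G.cls₁ o ∈ B
    · have : ∀ v, G.cls₁ v ∈ B := fun v => hB.2 G o v ho
      simp [massIn_cls₁, this]
    · have : ∀ v, G.cls₁ v ∉ B := fun v hv => ho (hB.2 G v o hv)
      simp [massIn_cls₁, this]

/-- The transport kernel is almost surely balancing at the root. -/
theorem IsUnimodular.ae_massOut_massIn_stableKernelNN [IsProbabilityMeasure μ]
    (hμ : IsUnimodular μ) {w₁ w₂ : GStar Ξ → ℝ≥0} (hw₁ : Measurable w₁) (hw₂ : Measurable w₂)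
    (h_eq : condLExp (invariantSigmaField Ξ) μ (fun x => (w₁ x : ℝ≥0∞)) =ᵐ[μ]
      condLExp (invariantSigmaField Ξ) μ (fun x => (w₂ x : ℝ≥0∞)))
    (h_fin : ∀ᵐ x ∂μ, condLExp (invariantSigmaField Ξ) μ (fun x => (w₁ x : ℝ≥0∞)) x < ∞) :
    ∀ᵐ x ∂μ, massOut (stableKernelNN w₁ w₂) x = w₁ x ∧ massIn (stableKernelNN w₁ w₂) x = w₂ x := by
  set T := stableKernelNN w₁ w₂
  have hTm : Measurable T := (measurable_stableKernel hw₁ hw₂).real_toNNReal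
  have hout := measurable_massOut hTm
  have hin := measurable_massIn hTm
  set φ := condLExp (invariantSigmaField Ξ) μ (fun x => (w₁ x : ℝ≥0∞))
  have hw : ∀ C, MeasurableSet[invariantSigmaField Ξ] C →
      ∫⁻ x in C, w₁ x ∂μ = ∫⁻ x in C, w₂ x ∂μ := by
    intro C hC
    rw [← setLIntegral_condLExp invariantSigmaField_le μ (fun x => (w₁ x : ℝ≥0∞)) hC,
      ← setLIntegral_condLExp invariantSigmaField_le μ (fun x => (w₂ x : ℝ≥0∞)) hC]
    exact lintegral_congr_ae (ae_restrict_of_ae h_eq)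
  -- `w₁` need not be integrable, but its integral is finite on invariant events where the
  -- conditional expectation is bounded.
  have hfin : ∀ C, MeasurableSet[invariantSigmaField Ξ] C → ∀ n : ℕ, (∀ x ∈ C, φ x ≤ n) →
      ∫⁻ x in C, w₁ x ∂μ ≠ ∞ := by
    intro C hC n hn
    rw [← setLIntegral_condLExp invariantSigmaField_le μ (fun x => (w₁ x : ℝ≥0∞)) hC]
    refine ne_of_lt (lt_of_le_of_lt (setLIntegral_mono' hC.1 hn) ?_)
    rw [setLIntegral_const]
    exact ENNReal.mul_lt_top (ENNReal.natCast_lt_top n) (measure_lt_top _ _)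
  have hlow : ∀ n : ℕ, MeasurableSet[invariantSigmaField Ξ] {x | φ x ≤ n} := fun n =>
    measurable_condLExp (invariantSigmaField Ξ) μ _ measurableSet_Iic
  set E : Set (GStar Ξ) := {x | ∀ (G : Network Ξ) (o : G.V), G.cls₁ o = x →
    ∀ v : G.V, G.cls₁ v ∈ {y | massOut T y = w₁ y}}
  have hEm : MeasurableSet[invariantSigmaField Ξ] E :=
    measurableSet_forall_vertex (measurableSet_eq_fun hout hw₁.coe_nnreal_ennreal)
  have hE1 : ∀ x ∈ E, massOut T x = w₁ x := by
    intro x hx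
    obtain ⟨G, o, rfl⟩ := x.exists_cls₁
    exact hx G o rfl o
  -- Some site of the network is not exhausted, so the dichotomy makes every center sated, in
  -- particular the root.
  have hE2 : ∀ x ∈ Eᶜ, massIn T x = w₂ x := by
    intro x hx
    have hx' : ¬ ∀ (G : Network Ξ) (o : G.V), G.cls₁ o = x →
      ∀ v : G.V, massOut T (G.cls₁ v) = w₁ (G.cls₁ v) := hx
    push Not at hx'
    obtain ⟨G, o, rfl, v, hv⟩ := hx'
    exact (massOut_or_massIn_stableKernelNN_eq w₁ w₂ G).resolve_left (fun h => hv (h v)) o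
  have h1 : ∀ n : ℕ, ∀ᵐ x ∂μ, x ∈ {x | φ x ≤ n} ∩ E → massIn T x = w₂ x := by
    intro n
    have hC := @MeasurableSet.inter _ (invariantSigmaField Ξ) _ _ (hlow n) hEm
    rw [← ae_restrict_iff' hC.1]
    -- Mass transport turns `T⁻` into `T⁺`, which is `w₁` on `E`. Since `T⁻ ≤ w₂` pointwise and the
    -- integrals agree and are finite, equality holds almost everywhere.
    have hI : ∫⁻ x in {x | φ x ≤ n} ∩ E, massIn T x ∂μ =
        ∫⁻ x in {x | φ x ≤ n} ∩ E, w₁ x ∂μ := by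
      rw [← hμ.setLIntegral_massOut hC hTm]
      exact setLIntegral_congr_fun hC.1 fun x hx => hE1 x hx.2
    refine ae_eq_of_ae_le_of_lintegral_le
      (Eventually.of_forall (massIn_stableKernelNN_le w₁ w₂)) ?_
      hw₂.coe_nnreal_ennreal.aemeasurable ?_
    · rw [hI]
      exact hfin _ hC n fun x hx => hx.1
    · rw [hI, hw _ hC]
  have h2 : ∀ n : ℕ, ∀ᵐ x ∂μ, x ∈ {x | φ x ≤ n} ∩ Eᶜ → massOut T x = w₁ x := by
    intro n
    have hC := @MeasurableSet.inter _ (invariantSigmaField Ξ) _ _ (hlow n)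
      (@MeasurableSet.compl _ _ (invariantSigmaField Ξ) hEm)
    rw [← ae_restrict_iff' hC.1]
    have hI : ∫⁻ x in {x | φ x ≤ n} ∩ Eᶜ, massOut T x ∂μ =
        ∫⁻ x in {x | φ x ≤ n} ∩ Eᶜ, w₁ x ∂μ := by
      rw [hμ.setLIntegral_massOut hC hTm, hw _ hC]
      exact setLIntegral_congr_fun hC.1 fun x hx => hE2 x hx.2
    refine ae_eq_of_ae_le_of_lintegral_le
      (Eventually.of_forall (massOut_stableKernelNN_le w₁ w₂)) ?_
      hw₁.coe_nnreal_ennreal.aemeasurable hI.ge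
    rw [hI]
    exact hfin _ hC n fun x hx => hx.1
  filter_upwards [ae_all_iff.2 h1, ae_all_iff.2 h2, h_fin] with x hx1 hx2 hx
  obtain ⟨n, hn⟩ := ENNReal.exists_nat_gt hx.ne
  by_cases hxE : x ∈ E
  · exact ⟨hE1 x hxE, hx1 n ⟨hn.le, hxE⟩⟩
  · exact ⟨hx2 n ⟨hn.le, hxE⟩, hE2 x hxE⟩

end Balance

/-! ### The balancing theorem -/

theorem mainTheorem5 {Ξ : Type*} [MetricSpace Ξ] [CompleteSpace Ξ]
    [TopologicalSpace.SeparableSpace Ξ]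
    (μ : Measure (GStar Ξ)) [IsProbabilityMeasure μ] (hμ : IsUnimodular μ)
    (w₁ w₂ : GStar Ξ → ℝ≥0) (hw₁ : Measurable w₁) (hw₂ : Measurable w₂)
    (h_eq : condLExp (invariantSigmaField Ξ) μ (fun x => (w₁ x : ℝ≥0∞)) =ᵐ[μ]
      condLExp (invariantSigmaField Ξ) μ (fun x => (w₂ x : ℝ≥0∞)))
    (h_fin : ∀ᵐ x ∂μ, condLExp (invariantSigmaField Ξ) μ (fun x => (w₁ x : ℝ≥0∞)) x < ∞) :
    (∀ G : Network Ξ, StableTransport.WellDefined G.graph.dist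
      (fun v => (w₁ (G.cls₁ v) : ℝ)) (fun v => (w₂ (G.cls₁ v) : ℝ))) ∧
    Measurable (stableKernel w₁ w₂) ∧ (∀ p, 0 ≤ stableKernel w₁ w₂ p) ∧
    ∀ᵐ x ∂μ, ∀ (G : Network Ξ) (o : G.V), G.cls₁ o = x → ∀ v : G.V,
      HasSum (fun ξ => stableKernel w₁ w₂ (G.cls₂ v ξ)) (w₁ (G.cls₁ v) : ℝ) ∧
      HasSum (fun ξ => stableKernel w₁ w₂ (G.cls₂ ξ v)) (w₂ (G.cls₁ v) : ℝ) := by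
  refine ⟨fun G => StableTransport.wellDefined G.finite_ball G.finite_ball'
    (fun _ => NNReal.coe_nonneg _) (fun _ => NNReal.coe_nonneg _),
    measurable_stableKernel hw₁ hw₂, stableKernel_nonneg w₁ w₂, ?_⟩
  have hT : Measurable (stableKernelNN w₁ w₂) := (measurable_stableKernel hw₁ hw₂).real_toNNReal
  -- Balance is a measurable property of the rooted class which holds almost surely at the root,
  -- hence at all vertices.
  filter_upwards [hμ.ae_forall_vertex
    ((measurableSet_eq_fun (measurable_massOut hT) hw₁.coe_nnreal_ennreal).inter
      (measurableSet_eq_fun (measurable_massIn hT) hw₂.coe_nnreal_ennreal))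
    (hμ.ae_massOut_massIn_stableKernelNN hw₁ hw₂ h_eq h_fin)] with x hx G o ho v
  exact ⟨(massOut_stableKernelNN_eq_iff w₁ w₂ G v _).1 (hx G o ho v).1,
    (massIn_stableKernelNN_eq_iff w₁ w₂ G v _).1 (hx G o ho v).2⟩
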